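/- Let $G=(V,E)$ be a finite directed graph and let $D\subseteq E\times\mathbb{N}^+$ be a finite set of demands; write $\Lambda(D)=\max_{(e,t)\in D}t$ (and $\Lambda(\emptyset)=0$). A temporal walk is a sequence $p=((v_0,t_0),\dots,(v_k,t_k))$, $k\ge 0$, with $v_i\in V$, $t_i\in\mathbb{N}$, $t_0<t_1<\dots<t_k$, such that $(v_{i-1},v_i)\in E$ and $1\le t_{i-1}\le\Lambda(D)$ for $1\le i\le k$; it uses the temporal edges $((v_{i-1},v_i),t_{i-1})$. Its length is $\ell(p)=k$ and its lifespan is $\tau(p)=t_k-t_0$. A schedule is a finite set of temporal walks no two of which use a common temporal edge; it extends $D$ if every $(e,t)\in D$ is used by one of its walks. For $\chi\in\{\ell,\tau\}$, an instance of Min-$\chi$-TEDSC consists of $G$, $D$ and an integer $h\ge 1$. A feasible solution is a schedule $S$ that extends $D$ and satisfies $\chi(p)\le h$ for all $p\in S$, and $\mathrm{OPT}$ is the minimum of $|S|$ over all feasible solutions $S$. **Theorem.** For each $\chi\in\{\ell,\tau\}$ there is a deterministic algorithm that, given an instance $(G,D,h)$ of Min-$\chi$-TEDSC (with the vertices, edges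 and demands listed explicitly, and all numbers, in particular $h$ and the time steps of the demands, written in binary), computes a feasible solution $S$ with $$|S|\le\Bigl(2-\frac1h\Bigr)\cdot\mathrm{OPT}$$ in time polynomial in the size of the input. -/

import Mathlib

/-! ## Temporal walks and schedules -/

namespace TEDSC

section Walks

variable {V : Type*}

/-- The time-edge `((u, v), t)` is the edge `(u, v)` used at time step `t`: one leaves `u` at
time `t` and is at `v` at time `t + 1`. -/
abbrev TimeEdge (V : Type*) := (V × V) × ℕ

/-- The time-edges of a sequence of time-vertices `(v₀, t₀), …, (v_k, t_k)`, namely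
`((v₀, v₁), t₀), …, ((v_{k-1}, v_k), t_{k-1})`. -/
def walkEdges (p : List (V × ℕ)) : List (TimeEdge V) :=
  List.zipWith (fun a b => ((a.1, b.1), a.2)) p p.tail

/-- The sequence `p = (v₀, t₀), …, (v_k, t_k)` (with `k ≥ 0`) is a strict temporal walk in the
temporal graph whose set of time-edges is `T`. -/
def IsTemporalWalk (T : Set (TimeEdge V)) (p : List (V × ℕ)) : Prop :=
  p ≠ [] ∧ (p.map Prod.snd).IsChain (· < ·) ∧ ∀ e ∈ walkEdges p, e ∈ T

/-- The length `ℓ(p) = k`: the number of time-edges. -/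
def walkLength (p : List (V × ℕ)) : ℕ := (walkEdges p).length

/-- The lifespan `τ(p) = t_k - t₀`. -/
def walkLifespan : List (V × ℕ) → ℕ
  | [] => 0
  | a :: p => ((a :: p).getLast (List.cons_ne_nil a p)).2 - a.2

/-- Two temporal walks are temporally edge disjoint if they share no time-edge. -/
def TED (p q : List (V × ℕ)) : Prop := (walkEdges p).Disjoint (walkEdges q)

/-- The lifetime `Λ(D)` of a draft schedule, its latest time step (`0` if `D` is empty). -/
def lifetime (D : Finset (TimeEdge V)) : ℕ := D.sup Prod.snd

/-- The time-edges of the temporal graph in which every edge of `G` is available at all the time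
steps `1, …, Λ(D)`. -/
def timeEdges (G : Digraph V) (D : Finset (TimeEdge V)) : Set (TimeEdge V) :=
  {e | G.Adj e.1.1 e.1.2 ∧ 1 ≤ e.2 ∧ e.2 ≤ lifetime D}

/-- `S` is a schedule for `D`: a set of pairwise temporally edge disjoint temporal walks. -/
def IsSchedule (G : Digraph V) (D : Finset (TimeEdge V)) (S : Finset (List (V × ℕ))) : Prop :=
  (∀ p ∈ S, IsTemporalWalk (timeEdges G D) p) ∧ (S : Set (List (V × ℕ))).Pairwise TED

/-- `S` extends `D`: every demand is traversed by some walk of `S`. -/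
def Extends (D : Finset (TimeEdge V)) (S : Finset (List (V × ℕ))) : Prop :=
  ∀ d ∈ D, ∃ p ∈ S, d ∈ walkEdges p

end Walks

/-- The quantity `χ ∈ {ℓ, τ}` that is bounded on every walk. -/
inductive Bounded
  | length
  | lifespan

/-- `χ(p)`. -/
def Bounded.cost {V : Type*} : Bounded → List (V × ℕ) → ℕ
  | .length => walkLength
  | .lifespan => walkLifespan

/-- An instance `(G, D, h)` of Min-`χ`-TEDSC. -/
structure Instance where
  /-- the number of vertices -/
  n : ℕ
  /-- the directed graph -/
  G : Digraph (Fin n)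
  /-- the draft schedule -/
  D : Finset (TimeEdge (Fin n))
  /-- the bound on the length or lifespan of each walk -/
  h : ℕ
  adj_of_mem : ∀ d ∈ D, G.Adj d.1.1 d.1.2
  pos_of_mem : ∀ d ∈ D, 1 ≤ d.2
  h_pos : 1 ≤ h

/-- `S` is a feasible solution: a schedule that extends `D` all of whose walks `p` satisfy
`χ(p) ≤ h`. -/
def Instance.Feasible (I : Instance) (χ : Bounded) (S : Finset (List (Fin I.n × ℕ))) : Prop :=
  IsSchedule I.G I.D S ∧ Extends I.D S ∧ ∀ p ∈ S, χ.cost p ≤ I.h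

/-- The minimum number of walks of a feasible solution. -/
noncomputable def Instance.opt (I : Instance) (χ : Bounded) : ℕ :=
  sInf {m | ∃ S, I.Feasible χ S ∧ S.card = m}

/-! ## Programs with a running time

Programs transform binary trees whose leaves carry natural numbers. They are built from
projections, pairing, addition and truncated subtraction by composition, case distinction and
while loops. Time is bit cost: every elementary step is charged one plus the bit size of the data
it is applied to, and every duplication of the data and every test is charged likewise. All the
elementary steps can be carried out by a Turing machine in time polynomial in what is charged for
them, and the size of the output never exceeds the time, so that polynomial time here gives polynomial
time on Turing machines. -/

/-- Data: binary trees with natural numbers at the leaves. -/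
inductive Data
  | nat (a : ℕ)
  | pair (x y : Data)

namespace Data

/-- Bit size; the number at a leaf is written in binary. -/
def size : Data → ℕ
  | nat a => 1 + Nat.size a
  | pair x y => 1 + size x + size y

/-- Lists as right-nested pairs that end in `0`. -/
def ofList : List Data → Data
  | [] => nat 0
  | x :: l => pair x (ofList l)

end Data

/-- Elementary operations. -/
inductive Prim
  | id
  | const (a : ℕ)
  | fst
  | snd
  | add
  | sub

/-- The effect of an elementary operation; it is `0` on data of the wrong shape. -/
def Prim.eval : Prim → Data → Data
  | .id, x => x
  | .const a, _ => .nat a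
  | .fst, .pair x _ => x
  | .snd, .pair _ y => y
  | .add, .pair (.nat a) (.nat b) => .nat (a + b)
  | .sub, .pair (.nat a) (.nat b) => .nat (a - b)
  | _, _ => .nat 0

/-- Programs. -/
inductive Prog
  /-- an elementary operation -/
  | prim (o : Prim)
  /-- run `p` and `q` on the same data and pair the results -/
  | pair (p q : Prog)
  /-- first `p`, then `q` -/
  | seq (p q : Prog)
  /-- run `p` if the test `c` gives something other than `0`, and `q` otherwise -/
  | ite (c p q : Prog)
  /-- repeat `p` as long as the test `c` gives something other than `0` -/
  | loop (c p : Prog)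

/-- `Runs P x y t`: the program `P`, started on `x`, stops with result `y` after time `t`. -/
inductive Runs : Prog → Data → Data → ℕ → Prop
  | prim (o : Prim) (x : Data) :
      Runs (.prim o) x (o.eval x) (1 + x.size + (o.eval x).size)
  | pair {p q : Prog} {x y z : Data} {s t : ℕ} :
      Runs p x y s → Runs q x z t → Runs (.pair p q) x (.pair y z) (1 + x.size + s + t)
  | seq {p q : Prog} {x y z : Data} {s t : ℕ} :
      Runs p x y s → Runs q y z t → Runs (.seq p q) x z (1 + s + t)
  | ite_true {c p q : Prog} {x b y : Data} {s t : ℕ} :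
      Runs c x b s → b ≠ .nat 0 → Runs p x y t → Runs (.ite c p q) x y (1 + x.size + s + t)
  | ite_false {c p q : Prog} {x y : Data} {s t : ℕ} :
      Runs c x (.nat 0) s → Runs q x y t → Runs (.ite c p q) x y (1 + x.size + s + t)
  | loop_stop {c p : Prog} {x : Data} {s : ℕ} :
      Runs c x (.nat 0) s → Runs (.loop c p) x x (1 + x.size + s)
  | loop_step {c p : Prog} {x b y z : Data} {s t r : ℕ} :
      Runs c x b s → b ≠ .nat 0 → Runs p x y t → Runs (.loop c p) y z r →
      Runs (.loop c p) x z (1 + x.size + s + t + r)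

/-- Programs are deterministic. -/
theorem Runs.unique {P : Prog} {x y z : Data} {s t : ℕ} (h₁ : Runs P x y s)
    (h₂ : Runs P x z t) : y = z ∧ s = t := by
  induction h₁ generalizing z t with
  | prim o x => cases h₂; exact ⟨rfl, rfl⟩
  | pair _ _ ih₁ ih₂ =>
    cases h₂ with
    | pair a b =>
      obtain ⟨rfl, rfl⟩ := ih₁ a
      obtain ⟨rfl, rfl⟩ := ih₂ b
      exact ⟨rfl, rfl⟩
  | seq _ _ ih₁ ih₂ =>
    cases h₂ with
    | seq a b =>
      obtain ⟨rfl, rfl⟩ := ih₁ a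
      obtain ⟨rfl, rfl⟩ := ih₂ b
      exact ⟨rfl, rfl⟩
  | ite_true _ hb _ ih₁ ih₂ =>
    cases h₂ with
    | ite_true a _ b =>
      obtain ⟨rfl, rfl⟩ := ih₁ a
      obtain ⟨rfl, rfl⟩ := ih₂ b
      exact ⟨rfl, rfl⟩
    | ite_false a b => exact absurd (ih₁ a).1 hb
  | ite_false _ _ ih₁ ih₂ =>
    cases h₂ with
    | ite_true a hb b => exact absurd (ih₁ a).1.symm hb
    | ite_false a b =>
      obtain ⟨-, rfl⟩ := ih₁ a
      obtain ⟨rfl, rfl⟩ := ih₂ b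
      exact ⟨rfl, rfl⟩
  | loop_stop _ ih₁ =>
    cases h₂ with
    | loop_stop a =>
      obtain ⟨-, rfl⟩ := ih₁ a
      exact ⟨rfl, rfl⟩
    | loop_step a hb _ _ => exact absurd (ih₁ a).1.symm hb
  | loop_step _ hb _ _ ih₁ ih₂ ih₃ =>
    cases h₂ with
    | loop_stop a => exact absurd (ih₁ a).1 hb
    | loop_step a _ b c =>
      obtain ⟨rfl, rfl⟩ := ih₁ a
      obtain ⟨rfl, rfl⟩ := ih₂ b
      obtain ⟨rfl, rfl⟩ := ih₃ c
      exact ⟨rfl, rfl⟩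

/-! ## Encodings -/

/-- A vertex is given by its number. -/
def vertexCode {n : ℕ} (v : Fin n) : Data := .nat v

/-- An edge is given by its two ends. -/
def edgeCode {n : ℕ} (e : Fin n × Fin n) : Data := .pair (vertexCode e.1) (vertexCode e.2)

/-- A demand is given by its edge and its time step. -/
def demandCode {n : ℕ} (d : TimeEdge (Fin n)) : Data := .pair (edgeCode d.1) (.nat d.2)

/-- A walk is given by the list of its time-vertices. -/
def walkCode {n : ℕ} (p : List (Fin n × ℕ)) : Data :=
  .ofList (p.map fun a => .pair (vertexCode a.1) (.nat a.2))

/-- `x` encodes the instance `I`: it consists of the list of the vertices, a list of the edges and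
a list of the demands, both in any order and without repetitions, and the number `h`. -/
def Instance.IsCode (I : Instance) (x : Data) : Prop :=
  ∃ (es : List (Fin I.n × Fin I.n)) (ds : List (TimeEdge (Fin I.n))),
    es.Nodup ∧ (∀ e, e ∈ es ↔ I.G.Adj e.1 e.2) ∧
    ds.Nodup ∧ (∀ d, d ∈ ds ↔ d ∈ I.D) ∧
    x = .pair (.ofList ((List.finRange I.n).map vertexCode))
      (.pair (.ofList (es.map edgeCode)) (.pair (.ofList (ds.map demandCode)) (.nat I.h)))

/-- `y` encodes the finite set `S` of walks: it is a list of its elements in any order and without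
repetitions. -/
def IsScheduleCode {n : ℕ} (S : Finset (List (Fin n × ℕ))) (y : Data) : Prop :=
  ∃ ps : List (List (Fin n × ℕ)),
    ps.Nodup ∧ (∀ p, p ∈ ps ↔ p ∈ S) ∧ y = .ofList (ps.map walkCode)

end TEDSC

/-!
An optimal solution, without the bound `h` on its walks, is computed for a different objective, and
its walks are then cut into pieces.

Charge every walk `h` plus the sum of its weights, where the weight of two consecutive time-edges is
`1` for the length and the difference of their times for the lifespan, so that `χ` of a walk that
ends on arrival by its last time-edge is one more than its total weight. A walk with `χ ≤ h` then
costs at most `2 * h - 1`, hence an optimal feasible solution at most `(2 * h - 1) * OPT`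
(`Instance.Feasible.coverCost_le`). Conversely, cutting the walks of a schedule greedily, whenever
the total weight reaches `h`, gives a feasible solution, and every piece uses up a share of at least
`h` of the cost (`Pieces.mul_length_le`). Hence a schedule of minimum cost is cut into at most `(2 -
1 / h) * OPT` pieces.

A schedule whose walks begin and end with demands is the same as a permutation of the time-edges: a
time-edge is mapped to its successor in its walk, the last one of a walk to the first one, and an
unused one to itself. With the costs `succCost`, a schedule of minimum cost is therefore a solution
of an assignment problem, for which the Hungarian method is used. Its dual values certify optimality
(`Hungarian.matching_spec`), and `sum_le_coverCost` compares them with arbitrary schedules.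

As time steps are written in binary, only few of them may be considered. In a schedule of minimum
cost with as few time-edges as possible, a walk visits no vertex twice between two demands, because
it could wait there instead, so there are at most as many time-edges as there are pairs of a vertex
and a demand (`exists_short_cover`). If these are moved, in their order, as early as the preceding
demand permits, every one of them comes to lie shortly after a demand (`exists_cover_kept`).

For the running time, functions computed by programs in polynomial time are shown to be closed under
composition, case distinction, and folds over lists whose intermediate results remain of polynomial
size (`PolyTime.foldl`). The algorithm is written as a function on lists, for which `fun_prop` can
then establish polynomial time.
-/

namespace TEDSC

open scoped List

/-! ### Polynomially bounded functions -/

/-- `B` is bounded by a polynomial with natural coefficients. -/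
@[fun_prop]
def PolyBdd (B : ℕ → ℕ) : Prop := ∃ T : Polynomial ℕ, ∀ n, B n ≤ T.eval n

theorem eval_mono (T : Polynomial ℕ) : Monotone fun n => T.eval n := by
  intro a b hab
  simp only [Polynomial.eval_eq_sum_range]
  gcongr

namespace PolyBdd

variable {f g : ℕ → ℕ}

@[fun_prop]
theorem id' : PolyBdd fun n => n := ⟨.X, by simp⟩

@[fun_prop]
theorem const (c : ℕ) : PolyBdd fun _ => c := ⟨.C c, by simp⟩

@[fun_prop]
theorem comp (hf : PolyBdd f) (hg : PolyBdd g) : PolyBdd fun n => f (g n) := by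
  obtain ⟨T, hT⟩ := hf
  obtain ⟨S, hS⟩ := hg
  exact ⟨T.comp S, fun n => by
    rw [Polynomial.eval_comp]; exact (hT _).trans (eval_mono T (hS n))⟩

@[fun_prop]
theorem add (hf : PolyBdd f) (hg : PolyBdd g) : PolyBdd fun n => f n + g n := by
  obtain ⟨T, hT⟩ := hf
  obtain ⟨S, hS⟩ := hg
  exact ⟨T + S, fun n => by rw [Polynomial.eval_add]; exact add_le_add (hT n) (hS n)⟩

@[fun_prop]
theorem mul (hf : PolyBdd f) (hg : PolyBdd g) : PolyBdd fun n => f n * g n := by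
  obtain ⟨T, hT⟩ := hf
  obtain ⟨S, hS⟩ := hg
  exact ⟨T * S, fun n => by rw [Polynomial.eval_mul]; exact Nat.mul_le_mul (hT n) (hS n)⟩

@[fun_prop]
theorem eval (T : Polynomial ℕ) : PolyBdd fun n => T.eval n := ⟨T, fun _ => le_rfl⟩

end PolyBdd

/-! ### Functions computable in polynomial time -/

/-- Types whose elements are encoded as data. -/
class Code (α : Type) where
  /-- the encoding -/
  code : α → Data

open Code (code)

instance : Code ℕ := ⟨Data.nat⟩

instance : Code Bool := ⟨fun b => .nat (cond b 1 0)⟩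

instance {α β : Type} [Code α] [Code β] : Code (α × β) := ⟨fun p => .pair (code p.1) (code p.2)⟩

instance {α : Type} [Code α] : Code (List α) := ⟨fun l => .ofList (l.map code)⟩

/-- The bit size of the encoding of `a`. -/
def csize {α : Type} [Code α] (a : α) : ℕ := (code a).size

/-- The function `f` is computed by a program in time polynomial in the size of its argument. -/
@[fun_prop]
def PolyTime {α β : Type} [Code α] [Code β] (f : α → β) : Prop :=
  ∃ (P : Prog) (B : ℕ → ℕ), PolyBdd B ∧ Monotone B ∧
    ∀ a, ∃ t, Runs P (code a) (code (f a)) t ∧ t ≤ B (csize a)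

section Closure

variable {α β γ : Type} [Code α] [Code β] [Code γ]

theorem PolyTime.of_runs {f : α → β} (P : Prog) {B : ℕ → ℕ} (hB : PolyBdd B)
    (h : ∀ a, ∃ t, Runs P (code a) (code (f a)) t ∧ t ≤ B (csize a)) : PolyTime f := by
  obtain ⟨T, hT⟩ := hB
  refine ⟨P, fun n => T.eval n, .eval T, eval_mono T, fun a => ?_⟩
  obtain ⟨t, h1, h2⟩ := h a
  exact ⟨t, h1, h2.trans (hT _)⟩

theorem Runs.size_le {P : Prog} {x y : Data} {t : ℕ} (h : Runs P x y t) : y.size ≤ t := by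
  induction h <;> try simp only [Data.size] at *
  all_goals omega

/-- The output is of polynomial size, since its size is charged for. -/
theorem PolyTime.size_le {f : α → β} (hf : PolyTime f) :
    ∃ B : ℕ → ℕ, PolyBdd B ∧ Monotone B ∧ ∀ a, csize (f a) ≤ B (csize a) := by
  obtain ⟨P, B, hB, hm, h⟩ := hf
  refine ⟨B, hB, hm, fun a => ?_⟩
  obtain ⟨t, h1, h2⟩ := h a
  exact h1.size_le.trans h2

theorem csize_pair (p : α × β) : csize p = 1 + csize p.1 + csize p.2 := rfl
theorem csize_nat (n : ℕ) : csize n = 1 + Nat.size n := rfl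
theorem csize_nil : csize ([] : List α) = 1 := rfl
theorem csize_cons (a : α) (l : List α) : csize (a :: l) = 1 + csize a + csize l := rfl

theorem one_le_csize (a : α) : 1 ≤ csize a := by
  unfold csize
  cases code a <;> simp only [Data.size] <;> omega

theorem csize_append (l l' : List α) : csize (l ++ l') + 1 = csize l + csize l' := by
  induction l with
  | nil => simp [csize_nil]; omega
  | cons a l ih => simp only [List.cons_append, csize_cons]; omega

theorem length_lt_csize (l : List α) : l.length < csize l := by
  induction l with
  | nil => simp [csize_nil]
  | cons a l ih => simp only [List.length_cons, csize_cons]; have := one_le_csize a; omega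

theorem csize_lt_of_mem {a : α} {l : List α} (h : a ∈ l) : csize a < csize l := by
  induction l with
  | nil => simp at h
  | cons b l ih =>
    rw [csize_cons]
    rcases List.mem_cons.1 h with rfl | h
    · have := one_le_csize l; omega
    · have := ih h; omega

theorem csize_list_le {l : List α} {b : ℕ} (h : ∀ a ∈ l, csize a ≤ b) :
    csize l ≤ 1 + l.length * (1 + b) := by
  induction l with
  | nil => simp [csize_nil]
  | cons a l ih =>
    rw [csize_cons, List.length_cons, add_mul]
    have := h a (by simp)
    have := ih fun a ha => h a (by simp [ha])
    omega

theorem csize_filter_le (p : α → Bool) (l : List α) : csize (l.filter p) ≤ csize l := by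
  induction l with
  | nil => simp
  | cons a l ih =>
    rw [List.filter_cons]
    split <;> simp only [csize_cons] <;> omega

theorem csize_filter_add (p : α → Bool) (l : List α) :
    csize (l.filter p) + csize (l.filter fun a => !p a) = csize l + 1 := by
  induction l with
  | nil => simp [csize_nil]
  | cons a l ih =>
    cases h : p a <;> simp only [List.filter_cons, h, csize_cons, Bool.not_false, Bool.not_true,
      if_true, Bool.false_eq_true, if_false] <;> omega

namespace PolyTime

/-- A function that an elementary operation carries out on the encodings is computable in polynomial
time. -/
theorem of_prim {f : α → β} (o : Prim) (h : ∀ a, o.eval (code a) = code (f a))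
    (hs : ∀ a, csize (f a) ≤ csize a + 1) : PolyTime f :=
  .of_runs (.prim o) (B := fun n => 2 * n + 2) (by fun_prop) fun a =>
    ⟨_, h a ▸ Runs.prim o (code a), by
      have := hs a
      simp only [csize] at *
      omega⟩

theorem congr {f g : α → β} (hf : PolyTime f) (h : ∀ a, f a = g a) : PolyTime g :=
  funext h ▸ hf

@[fun_prop]
theorem id' : PolyTime fun a : α => a := of_prim .id (fun _ => rfl) fun _ => by omega

@[fun_prop]
theorem comp {f : β → γ} {g : α → β} (hf : PolyTime f) (hg : PolyTime g) :
    PolyTime fun a => f (g a) := by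
  obtain ⟨P, B, hB, hm, h⟩ := hf
  obtain ⟨Q, C, hC, -, h'⟩ := hg
  refine .of_runs (.seq Q P) (B := fun n => 1 + C n + B (C n)) (by fun_prop) fun a => ?_
  obtain ⟨t, h1, h2⟩ := h' a
  obtain ⟨s, h3, h4⟩ := h (g a)
  refine ⟨_, h1.seq h3, ?_⟩
  have := h4.trans (hm (h1.size_le.trans h2))
  omega

@[fun_prop]
theorem prodMk {f : α → β} {g : α → γ} (hf : PolyTime f) (hg : PolyTime g) :
    PolyTime fun a => (f a, g a) := by
  obtain ⟨P, B, hB, -, h⟩ := hf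
  obtain ⟨Q, C, hC, -, h'⟩ := hg
  refine .of_runs (.pair P Q) (B := fun n => 1 + n + B n + C n) (by fun_prop) fun a => ?_
  obtain ⟨t, h1, h2⟩ := h a
  obtain ⟨s, h3, h4⟩ := h' a
  exact ⟨_, h1.pair h3, by simp only [csize] at *; omega⟩

theorem exists_const (d : Data) :
    ∃ (P : Prog) (B : ℕ → ℕ), PolyBdd B ∧ ∀ x, ∃ t, Runs P x d t ∧ t ≤ B x.size := by
  induction d with
  | nat c => exact ⟨.prim (.const c), fun n => 2 + n + Nat.size c, by fun_prop, fun x =>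
      ⟨_, .prim _ _, by simp only [Prim.eval, Data.size]; omega⟩⟩
  | pair d e ih ih' =>
    obtain ⟨P, B, hB, h⟩ := ih
    obtain ⟨Q, C, hC, h'⟩ := ih'
    refine ⟨.pair P Q, fun n => 1 + n + B n + C n, by fun_prop, fun x => ?_⟩
    obtain ⟨t, h1, h2⟩ := h x
    obtain ⟨s, h3, h4⟩ := h' x
    exact ⟨_, h1.pair h3, by dsimp only; omega⟩

@[fun_prop]
theorem const (b : β) : PolyTime fun _ : α => b := by
  obtain ⟨P, B, hB, h⟩ := exists_const (code b)
  exact .of_runs P hB fun a => h _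

@[fun_prop]
theorem fst {f : α → β × γ} (hf : PolyTime f) : PolyTime fun a => (f a).1 :=
  comp (of_prim .fst (fun _ => rfl) fun _ => by rw [csize_pair]; omega) hf

@[fun_prop]
theorem snd {f : α → β × γ} (hf : PolyTime f) : PolyTime fun a => (f a).2 :=
  comp (of_prim .snd (fun _ => rfl) fun _ => by rw [csize_pair]; omega) hf

theorem natSize_add_le (a b : ℕ) : Nat.size (a + b) ≤ Nat.size a + Nat.size b + 1 := by
  rw [Nat.size_le]
  have ha := Nat.lt_size_self a
  have hb := Nat.lt_size_self b
  have h1 : 2 ^ a.size ≤ 2 ^ (a.size + b.size) := Nat.pow_le_pow_right (by simp) (by omega)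
  have h2 : 2 ^ b.size ≤ 2 ^ (a.size + b.size) := Nat.pow_le_pow_right (by simp) (by omega)
  rw [pow_succ]
  omega

@[fun_prop]
theorem add {f g : α → ℕ} (hf : PolyTime f) (hg : PolyTime g) : PolyTime fun a => f a + g a :=
  comp (f := fun p : ℕ × ℕ => p.1 + p.2) (of_prim .add (fun _ => rfl) fun p => by
    simp only [csize_pair, csize_nat]; have := natSize_add_le p.1 p.2; omega) (prodMk hf hg)

@[fun_prop]
theorem sub {f g : α → ℕ} (hf : PolyTime f) (hg : PolyTime g) : PolyTime fun a => f a - g a :=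
  comp (f := fun p : ℕ × ℕ => p.1 - p.2) (of_prim .sub (fun _ => rfl) fun p => by
    simp only [csize_pair, csize_nat]
    have := Nat.size_le_size (Nat.sub_le p.1 p.2); omega) (prodMk hf hg)

@[fun_prop]
theorem cons {f : α → β} {g : α → List β} (hf : PolyTime f) (hg : PolyTime g) :
    PolyTime fun a => f a :: g a :=
  comp (f := fun p : β × List β => p.1 :: p.2) (of_prim .id (fun _ => rfl) fun p => by
    rw [csize_pair, csize_cons]; omega) (prodMk hf hg)

@[fun_prop]
theorem cond {c : α → Bool} {f g : α → β} (hc : PolyTime c) (hf : PolyTime f) (hg : PolyTime g) :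
    PolyTime fun a => bif c a then f a else g a := by
  obtain ⟨R, A, hA, -, h₀⟩ := hc
  obtain ⟨P, B, hB, -, h⟩ := hf
  obtain ⟨Q, C, hC, -, h'⟩ := hg
  refine .of_runs (.ite R P Q) (B := fun n => 1 + n + A n + B n + C n) (by fun_prop) fun a => ?_
  obtain ⟨r, h5, h6⟩ := h₀ a
  obtain ⟨t, h1, h2⟩ := h a
  obtain ⟨s, h3, h4⟩ := h' a
  cases hca : c a <;> rw [hca] at h5
  · exact ⟨_, .ite_false h5 h3, by simp only [csize] at *; omega⟩
  · exact ⟨_, .ite_true h5 (by simp [code]) h1, by simp only [csize] at *; omega⟩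

@[fun_prop]
theorem not {f : α → Bool} (hf : PolyTime f) : PolyTime fun a => !f a :=
  congr (cond hf (const false) (const true)) fun a => by cases f a <;> rfl

@[fun_prop]
theorem and {f g : α → Bool} (hf : PolyTime f) (hg : PolyTime g) : PolyTime fun a => f a && g a :=
  congr (cond hf hg (const false)) fun a => by cases f a <;> rfl

@[fun_prop]
theorem decide_le {f g : α → ℕ} (hf : PolyTime f) (hg : PolyTime g) :
    PolyTime fun a => decide (f a ≤ g a) := by
  have h : PolyTime fun n : ℕ => decide (n = 0) := by
    refine .of_runs (.ite (.prim .id) (.prim (.const 0)) (.prim (.const 1)))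
      (B := fun n => 10 + 10 * n) (by fun_prop) fun a => ?_
    by_cases ha : a = 0
    · subst ha
      exact ⟨_, .ite_false (.prim .id _) (.prim _ _), by decide⟩
    · have h0 : code (decide (a = 0)) = .nat 0 := by simp [code, ha]
      rw [h0]
      refine ⟨_, .ite_true (b := .nat a) (.prim .id _) (by simpa using ha) (.prim _ _), ?_⟩
      simp only [Prim.eval, Data.size, csize_nat, code, Nat.size_zero]
      omega
  exact congr (comp h (sub hf hg)) fun a => by simp [Nat.sub_eq_zero_iff_le]

@[fun_prop]
theorem decide_lt {f g : α → ℕ} (hf : PolyTime f) (hg : PolyTime g) :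
    PolyTime fun a => decide (f a < g a) :=
  congr (decide_le (add hf (const 1)) hg) fun a => by simp

end PolyTime

/-- Types with an equality test that takes polynomial time. -/
class PolyEq (α : Type) [Code α] [DecidableEq α] : Prop where
  polyTime_eq : PolyTime fun p : α × α => decide (p.1 = p.2)

namespace PolyTime

@[fun_prop]
theorem decide_eq [DecidableEq β] [PolyEq β] {f g : α → β} (hf : PolyTime f) (hg : PolyTime g) :
    PolyTime fun a => decide (f a = g a) :=
  comp PolyEq.polyTime_eq (prodMk hf hg)

instance : PolyEq ℕ where
  polyTime_eq := congr (f := fun p : ℕ × ℕ => decide (p.1 ≤ p.2) && decide (p.2 ≤ p.1))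
    (by fun_prop) fun p => by rw [← Bool.decide_and, decide_eq_decide]; omega

instance [DecidableEq α] [DecidableEq β] [PolyEq α] [PolyEq β] : PolyEq (α × β) where
  polyTime_eq := congr (f := fun p : (α × β) × (α × β) =>
      decide (p.1.1 = p.2.1) && decide (p.1.2 = p.2.2))
    (by fun_prop) fun p => by rw [← Bool.decide_and, decide_eq_decide, Prod.ext_iff]

end PolyTime

/-! ### Lists -/

/-- Case distinction on a list. -/
def listElim {β γ : Type*} (l : List β) (b : γ) (f : β → List β → γ) : γ :=
  match l with
  | [] => b
  | a :: l => f a l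

namespace PolyTime

@[fun_prop]
theorem listElim {l : α → List β} {b : α → γ} {f : α → β → List β → γ} (hl : PolyTime l)
    (hb : PolyTime b) (hf : PolyTime fun p : α × β × List β => f p.1 p.2.1 p.2.2) :
    PolyTime fun a => listElim (l a) (b a) (f a) := by
  obtain ⟨R, A, hA, hAm, h₀⟩ := prodMk id' hl
  obtain ⟨P, B, hB, -, h⟩ := hb
  obtain ⟨Q, C, hC, hCm, h'⟩ := hf
  refine .of_runs (.seq R (.ite (.prim .snd) Q (.seq (.prim .fst) P)))
    (B := fun n => 1 + A n + (1 + A n + (1 + A n + A n) + (C (A n) + (1 + (1 + A n + n) + B n))))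
    (by fun_prop) fun a => ?_
  obtain ⟨r, h5, h6⟩ := h₀ a
  dsimp only at h5
  have hsz := h5.size_le.trans h6
  cases hla : l a with
  | nil =>
    rw [hla] at h5 hsz
    obtain ⟨t, h1, h2⟩ := h a
    refine ⟨_, h5.seq (.ite_false (.prim .snd _) (.seq (.prim .fst _) h1)), ?_⟩
    simp only [code, Prim.eval, List.map_nil, Data.ofList, Data.size, Nat.size_zero, csize] at *
    omega
  | cons b l =>
    rw [hla] at h5 hsz
    obtain ⟨t, h1, h2⟩ := h' (a, b, l)
    refine ⟨_, h5.seq (.ite_true (b := code (b :: l)) (.prim .snd _)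
      (by simp [code, Data.ofList]) h1), ?_⟩
    have := h2.trans (hCm hsz)
    simp only [code, Prim.eval, List.map_cons, Data.ofList, Data.size, csize] at *
    omega

/-- A left fold takes polynomial time if every step does and the intermediate results stay of
polynomial size. -/
theorem foldl {l : α → List β} {b : α → γ} {f : α → γ → β → γ} (hl : PolyTime l)
    (hb : PolyTime b) (hf : PolyTime fun p : α × γ × β => f p.1 p.2.1 p.2.2)
    {S : ℕ → ℕ} (hS : PolyBdd S)
    (h : ∀ a l', l' <+: l a → csize (l'.foldl (f a) (b a)) ≤ S (csize a)) :
    PolyTime fun a => (l a).foldl (f a) (b a) := by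
  obtain ⟨R, A, hA, hAm, h₀⟩ := prodMk hb (prodMk hl id')
  obtain ⟨Q, C, hC, hCm, h'⟩ := hf
  -- The loop runs on triples of the current result, the rest of the list, and the argument.
  let arg : Prog := .pair (.seq (.prim .snd) (.prim .snd))
    (.pair (.prim .fst) (.seq (.prim .snd) (.seq (.prim .fst) (.prim .fst))))
  let rest : Prog := .pair (.seq (.prim .snd) (.seq (.prim .fst) (.prim .snd)))
    (.seq (.prim .snd) (.prim .snd))
  let test : Prog := .seq (.prim .snd) (.prim .fst)
  let body : Prog := .pair (.seq arg Q) rest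
  -- a bound for the size of the data, and one for the time of a round
  let Z : ℕ → ℕ := fun n => 2 + S n + A n + n
  let K : ℕ → ℕ := fun n => 100 + 100 * Z n + C (Z n)
  have key : ∀ a, ∀ l' l'' : List β, l' ++ l'' = l a → ∃ t,
      Runs (.loop test body) (code (l'.foldl (f a) (b a), l'', a))
        (code ((l a).foldl (f a) (b a), ([] : List β), a)) t ∧
      t ≤ (l''.length + 1) * K (csize a) := by
    intro a l' l''
    have hsl : csize (l a) ≤ A (csize a) := by
      obtain ⟨r, h5, h6⟩ := h₀ a
      have := h5.size_le.trans h6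
      simp only [code, Data.size, csize] at *
      omega
    induction l'' generalizing l' with
    | nil =>
      intro e
      rw [List.append_nil] at e
      subst e
      refine ⟨_, Runs.loop_stop (.seq (.prim .snd _) (.prim .fst _)), ?_⟩
      have := h a (l a) (List.prefix_refl _)
      simp only [code, Prim.eval, List.map_nil, Data.ofList, Data.size, Nat.size_zero, csize,
        K, Z, List.length_nil] at *
      omega
    | cons c l'' ih =>
      intro e
      have hs := h a l' ⟨_, e⟩
      have hs' := h a (l' ++ [c]) ⟨l'', by simpa using e⟩
      obtain ⟨t, h1, h2⟩ := h' (a, l'.foldl (f a) (b a), c)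
      obtain ⟨s, h3, h4⟩ := ih (l' ++ [c]) (by simpa using e)
      rw [List.foldl_append, List.foldl_cons, List.foldl_nil] at h3 hs'
      have hsz : csize l' + csize (c :: l'') = csize (l a) + 1 := by
        rw [← e, csize_append]
      rw [csize_cons] at hsz
      have hl1 := one_le_csize l'
      have hl2 := one_le_csize l''
      have h5 : C (csize (a, l'.foldl (f a) (b a), c)) ≤ C (Z (csize a)) := by
        apply hCm
        simp only [csize_pair, Z]
        omega
      refine ⟨_, .loop_step (b := code (c :: l'')) (.seq (.prim .snd _) (.prim .fst _))
        (by simp [code, Data.ofList])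
        (.pair (.seq (.pair (.seq (.prim .snd _) (.prim .snd _))
          (.pair (.prim .fst _) (.seq (.prim .snd _) (.seq (.prim .fst _) (.prim .fst _))))) h1)
          (.pair (.seq (.prim .snd _) (.seq (.prim .fst _) (.prim .snd _)))
            (.seq (.prim .snd _) (.prim .snd _)))) h3, ?_⟩
      have h6 : t ≤ C (Z (csize a)) := h2.trans h5
      rw [List.length_cons, add_mul _ 1, one_mul]
      refine (add_le_add_right h4 _).trans ?_
      rw [add_comm (_ * _)]
      refine Nat.add_le_add_right ?_ _
      simp only [code, Prim.eval, List.map_cons, Data.ofList, Data.size, csize, K, Z] at *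
      omega
  refine .of_runs (.seq R (.seq (.loop test body) (.prim .fst)))
    (B := fun n => 1 + A n + (1 + (A n + 1) * K n + (2 * Z n + 10))) (by fun_prop) fun a => ?_
  obtain ⟨r, h5, h6⟩ := h₀ a
  obtain ⟨t, h1, h2⟩ := key a [] (l a) rfl
  refine ⟨_, h5.seq (h1.seq (.prim .fst _)), ?_⟩
  have hsl : (l a).length ≤ A (csize a) := by
    have h7 := h5.size_le.trans h6
    have := length_lt_csize (l a)
    simp only [code, Data.size, csize] at *
    omega
  have h8 : t ≤ (A (csize a) + 1) * K (csize a) := h2.trans (by gcongr)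
  have := h a (l a) (List.prefix_refl _)
  simp only [code, Prim.eval, List.map_nil, Data.ofList, Data.size, Nat.size_zero, csize, Z] at *
  omega

/-- A left fold takes polynomial time if every step does and enlarges the intermediate result by an
amount that is polynomial in the size of the argument. -/
theorem foldl_of_add {l : α → List β} {b : α → γ} {f : α → γ → β → γ} (hl : PolyTime l)
    (hb : PolyTime b) (hf : PolyTime fun p : α × γ × β => f p.1 p.2.1 p.2.2)
    {S : ℕ → ℕ} (hS : PolyBdd S) (hm : Monotone S)
    (h : ∀ a s c, c ∈ l a → csize (f a s c) ≤ csize s + S (csize a + csize c)) :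
    PolyTime fun a => (l a).foldl (f a) (b a) := by
  obtain ⟨A, hA, -, hA'⟩ := hl.size_le
  obtain ⟨B, hB, -, hB'⟩ := hb.size_le
  refine foldl hl hb hf (S := fun n => B n + A n * S (n + A n)) (by fun_prop) fun a l' hl' => ?_
  have key : csize (l'.foldl (f a) (b a)) ≤
      csize (b a) + l'.length * S (csize a + A (csize a)) := by
    induction l' using List.reverseRecOn with
    | nil => simp
    | append_singleton l' c ih =>
      have hc : c ∈ l a := hl'.subset (by simp)
      have h1 := h a (l'.foldl (f a) (b a)) c hc
      have h2 := ih ((List.prefix_append _ _).trans hl')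
      have h3 : S (csize a + csize c) ≤ S (csize a + A (csize a)) := by
        have := hA' a
        have := csize_lt_of_mem hc
        exact hm (by omega)
      rw [List.foldl_append, List.foldl_cons, List.foldl_nil, List.length_append, add_mul]
      simp only [List.length_singleton, one_mul]
      omega
  have h1 : l'.length ≤ A (csize a) :=
    hl'.length_le.trans ((length_lt_csize _).le.trans (hA' a))
  exact key.trans (add_le_add (hB' a) (Nat.mul_le_mul_right _ h1))

@[fun_prop]
theorem reverse_append {f g : α → List β} (hf : PolyTime f) (hg : PolyTime g) :
    PolyTime fun a => (f a).reverse ++ g a :=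
  congr (foldl_of_add (f := fun _ s c => c :: s) hf hg (by fun_prop) (S := fun n => 1 + n)
    (by fun_prop) (fun _ _ _ => by dsimp only; omega) fun a s c _ => by rw [csize_cons]; omega)
    fun a => by simp [List.foldl_flip_cons_eq_append]

@[fun_prop]
theorem reverse {f : α → List β} (hf : PolyTime f) : PolyTime fun a => (f a).reverse :=
  congr (reverse_append hf (const [])) fun a => by simp

@[fun_prop]
theorem append {f g : α → List β} (hf : PolyTime f) (hg : PolyTime g) :
    PolyTime fun a => f a ++ g a :=
  congr (reverse_append (reverse hf) hg) fun a => by simp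

@[fun_prop]
theorem flatMap {l : α → List β} {f : α → β → List γ} (hl : PolyTime l)
    (hf : PolyTime fun p : α × β => f p.1 p.2) : PolyTime fun a => (l a).flatMap (f a) := by
  obtain ⟨A, hA, hAm, hA'⟩ := hf.size_le
  have hf' : PolyTime fun p : α × List γ × β => f p.1 p.2.2 :=
    comp hf (g := fun p : α × List γ × β => (p.1, p.2.2)) (by fun_prop)
  refine congr (reverse (foldl_of_add (f := fun a s c => (f a c).reverse ++ s) hl (const [])
    (by fun_prop) (S := fun n => A (1 + n)) (by fun_prop)
    (fun _ _ _ => hAm (by omega)) fun a s c _ => ?_)) fun a => ?_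
  · have h1 := csize_append (f a c).reverse s
    have h2 : csize (f a c).reverse = csize (f a c) := by
      generalize f a c = l
      induction l with
      | nil => rfl
      | cons x l ih =>
        have := csize_append l.reverse [x]
        rw [List.reverse_cons, csize_cons]
        rw [csize_cons, csize_nil] at this
        omega
    have h3 := hA' (a, c)
    rw [csize_pair] at h3
    simp only [← add_assoc] at h3 ⊢
    omega
  · suffices h : ∀ s, List.foldl (fun s c => (f a c).reverse ++ s) s (l a) =
        ((l a).flatMap (f a)).reverse ++ s by simp [h]
    induction l a with
    | nil => simp
    | cons x l ih => intro s; simp [ih]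

@[fun_prop]
theorem map {l : α → List β} {f : α → β → γ} (hl : PolyTime l)
    (hf : PolyTime fun p : α × β => f p.1 p.2) : PolyTime fun a => (l a).map (f a) :=
  congr (flatMap (f := fun a b => [f a b]) hl (by fun_prop)) fun a => by
    induction l a <;> simp_all

@[fun_prop]
theorem filter {l : α → List β} {f : α → β → Bool} (hl : PolyTime l)
    (hf : PolyTime fun p : α × β => f p.1 p.2) : PolyTime fun a => (l a).filter (f a) :=
  congr (flatMap (f := fun a b => bif f a b then [b] else []) hl (by fun_prop)) fun a => by
    induction l a with
    | nil => rfl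
    | cons x l ih => cases h : f a x <;> simp_all

@[fun_prop]
theorem any {l : α → List β} {f : α → β → Bool} (hl : PolyTime l)
    (hf : PolyTime fun p : α × β => f p.1 p.2) : PolyTime fun a => (l a).any (f a) :=
  congr (listElim (f := fun _ _ _ => true) (filter hl hf) (const false) (const true)) fun a => by
    induction l a with
    | nil => rfl
    | cons x l ih => cases h : f a x <;> simp_all [TEDSC.listElim]

@[fun_prop]
theorem decide_mem [DecidableEq β] [PolyEq β] {f : α → β} {l : α → List β}
    [∀ a, Decidable (f a ∈ l a)] (hf : PolyTime f) (hl : PolyTime l) :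
    PolyTime fun a => decide (f a ∈ l a) :=
  congr (any (f := fun a b => decide (f a = b)) hl (by fun_prop)) fun a => by
    rw [Bool.eq_iff_iff]; simp

@[fun_prop]
theorem product {f : α → List β} {g : α → List γ} (hf : PolyTime f) (hg : PolyTime g) :
    PolyTime fun a => f a ×ˢ g a :=
  congr (flatMap (f := fun a b => (g a).map fun c => (b, c)) hf (by fun_prop)) fun _ => rfl

@[fun_prop]
theorem sum {l : α → List ℕ} (hl : PolyTime l) : PolyTime fun a => (l a).sum :=
  congr (foldl_of_add (b := fun _ => 0) (f := fun _ s c => s + c) hl (const 0) (by fun_prop)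
    (S := fun n => 1 + n) (by fun_prop) (fun _ _ _ => by dsimp only; omega) fun a s c _ => by
      simp only [csize_nat]
      have := natSize_add_le s c
      omega) fun a => List.sum_eq_foldl.symm

@[fun_prop]
theorem length {l : α → List β} (hl : PolyTime l) : PolyTime fun a => (l a).length :=
  congr (sum (l := fun a => (l a).map fun _ => 1) (by fun_prop)) fun a => by simp

@[fun_prop]
theorem range_length {l : α → List β} (hl : PolyTime l) :
    PolyTime fun a => List.range (l a).length := by
  obtain ⟨A, hA, -, hA'⟩ := hl.size_le
  have key : ∀ l : List β, l.foldl (fun s _ => s.length :: s) [] =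
      (List.range l.length).reverse := by
    intro l
    induction l using List.reverseRecOn with
    | nil => rfl
    | append_singleton l c ih => simp [ih, List.range_succ]
  refine congr (reverse (foldl (b := fun _ => []) (f := fun _ s _ => s.length :: s) hl (const [])
    (by fun_prop) (S := fun n => 1 + A n * (2 + A n)) (by fun_prop) fun a l' hl' => ?_))
    fun a => by rw [key, List.reverse_reverse]
  rw [key]
  have hlen : l'.length ≤ A (csize a) :=
    hl'.length_le.trans ((length_lt_csize _).le.trans (hA' a))
  refine (csize_list_le (b := 1 + A (csize a)) fun n hn => ?_).trans ?_
  · rw [csize_nat]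
    have h1 : n < l'.length := by simpa using hn
    have h2 : Nat.size n ≤ n := Nat.size_le.2 Nat.lt_two_pow_self
    omega
  · rw [List.length_reverse, List.length_range, ← add_assoc 1 1]
    gcongr

end PolyTime

end Closure

/-! ### The Hungarian method -/

namespace Hungarian

variable {α : Type}

/-- The state of the Hungarian method for the assignment problem on a list of nodes, each of which
serves as a row and as a column. A matching is a list of pairs of a row and a column. -/
structure State (α : Type) where
  /-- every node `a` with the dual value `u a` of its row and the negated dual value `v a` of its
  column; dual feasibility means `u a ≤ c a b + v b` -/
  dual : List (α × ℕ × ℕ)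
  /-- the rows that have not been considered yet -/
  rest : List α
  /-- the columns in the alternating tree -/
  cols : List α
  /-- the rows in the alternating tree, each with a matching of all the rows considered so far but
  this one -/
  tree : List (α × List (α × α))
  /-- the matching that has been completed last -/
  out : List (α × α)

/-- The least pair of the list `x :: l`, in the order of first components. -/
def minFst {β : Type} (x : ℕ × β) (l : List (ℕ × β)) : ℕ × β :=
  l.foldl (fun m y => bif decide (y.1 < m.1) then y else m) x

/-- Start a new tree at the first of the rows `rest`, from the matching `μ`. -/
def advance (dual : List (α × ℕ × ℕ)) (rest : List α) (μ : List (α × α)) : State α :=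
  listElim rest ⟨dual, [], [], [], μ⟩ fun r rest => ⟨dual, rest, [], [(r, μ)], μ⟩

variable [DecidableEq α]

/-- Raise the dual values of the rows in the tree and lower those of its columns by `δ`. -/
def shift (s : State α) (δ : ℕ) : List (α × ℕ × ℕ) :=
  s.dual.map fun p => (p.1, bif decide (p.1 ∈ s.tree.map fun e => e.1) then p.2.1 + δ else p.2.1,
    bif decide (p.1 ∈ s.cols) then p.2.2 + δ else p.2.2)

/-- Process the pair `(i, j)` of a row `i` of the tree, with matching `μ`, and a column `j` outside
the tree, after shifting the dual values by the slack `δ` of this pair: if `j` is free, the matching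
is extended; otherwise the row matched to `j` joins the tree. -/
def update (s : State α) (δ : ℕ) (i j : α) (μ : List (α × α)) : State α :=
  listElim (μ.filter fun p => decide (p.2 = j)) (advance (shift s δ) s.rest ((i, j) :: μ))
    fun r _ => ⟨shift s δ, s.rest, j :: s.cols,
      (r.1, (i, j) :: μ.filter fun p => !decide (p.2 = j)) :: s.tree, s.out⟩

/-- The pairs of a row in the tree and a column outside, with their slack and the matching that goes
with the row. -/
def candidates (c : α → α → ℕ) (s : State α) : List (ℕ × α × α × List (α × α)) :=
  s.tree.flatMap fun e => (s.dual.filter fun p => decide (p.1 = e.1)).flatMap fun p =>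
    (s.dual.filter fun q => !decide (q.1 ∈ s.cols)).map fun q =>
      (c p.1 q.1 + q.2.2 - p.2.1, p.1, q.1, e.2)

/-- One step of the Hungarian method: process a pair of least slack. -/
def step (c : α → α → ℕ) (s : State α) : State α :=
  listElim (candidates c s) s fun x l =>
    update s (minFst x l).1 (minFst x l).2.1 (minFst x l).2.2.1 (minFst x l).2.2.2

/-- The state before the first step. -/
def init (nodes : List α) : State α := advance (nodes.map fun a => (a, 0, 0)) nodes []

/-- A perfect matching of the nodes to themselves of minimum cost. As every search for an augmenting
path adds fewer columns to its tree than there are nodes, the square of the number of nodes is an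
upper bound on the number of steps. -/
def matching (c : α → α → ℕ) (nodes : List α) : List (α × α) :=
  ((nodes ×ˢ nodes).foldl (fun s _ => step c s) (init nodes)).out

section Basic

theorem minFst_mem {β : Type} (x : ℕ × β) (l : List (ℕ × β)) : minFst x l ∈ x :: l := by
  unfold minFst
  induction l generalizing x with
  | nil => simp
  | cons y l ih =>
    rw [List.foldl_cons]
    cases decide (y.1 < x.1)
    · rcases List.mem_cons.1 (ih x) with h | h <;> simp [h]
    · rcases List.mem_cons.1 (ih y) with h | h <;> simp [h]

theorem minFst_le {β : Type} (x : ℕ × β) (l : List (ℕ × β)) :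
    ∀ y ∈ x :: l, (minFst x l).1 ≤ y.1 := by
  unfold minFst
  induction l generalizing x with
  | nil => simp
  | cons z l ih =>
    intro y hy
    rw [List.foldl_cons]
    by_cases h : z.1 < x.1
    · simp only [h, decide_true, cond_true]
      rcases List.mem_cons.1 hy with rfl | hy
      · exact (ih z z (by simp)).trans h.le
      · exact ih z y hy
    · simp only [h, decide_false, cond_false]
      rcases List.mem_cons.1 hy with rfl | hy
      · exact ih y y (by simp)
      · rcases List.mem_cons.1 hy with rfl | hy
        · exact (ih x x (by simp)).trans (not_lt.1 h)
        · exact ih x y (by simp [hy])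

theorem mem_candidates {c : α → α → ℕ} {s : State α} {m : ℕ × α × α × List (α × α)} :
    m ∈ candidates c s ↔ ∃ e ∈ s.tree, ∃ p ∈ s.dual, p.1 = e.1 ∧ ∃ q ∈ s.dual, q.1 ∉ s.cols ∧
      m = (c p.1 q.1 + q.2.2 - p.2.1, p.1, q.1, e.2) := by
  simp only [candidates, List.mem_flatMap, List.mem_filter, List.mem_map, decide_eq_true_eq,
    Bool.not_eq_true', decide_eq_false_iff_not, and_assoc, eq_comm (b := m)]

theorem step_cases (c : α → α → ℕ) (s : State α) :
    (candidates c s = [] ∧ step c s = s) ∨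
      ∃ m ∈ candidates c s, (∀ m' ∈ candidates c s, m.1 ≤ m'.1) ∧
        step c s = update s m.1 m.2.1 m.2.2.1 m.2.2.2 := by
  unfold step
  cases h : candidates c s with
  | nil => exact .inl ⟨rfl, rfl⟩
  | cons x l => exact .inr ⟨_, minFst_mem x l, minFst_le x l, rfl⟩

theorem update_cases (s : State α) (δ : ℕ) (i j : α) (μ : List (α × α)) :
    (j ∉ μ.map Prod.snd ∧ update s δ i j μ = advance (shift s δ) s.rest ((i, j) :: μ)) ∨
      ∃ r, (r, j) ∈ μ ∧ update s δ i j μ = ⟨shift s δ, s.rest, j :: s.cols,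
        (r, (i, j) :: μ.filter fun p => !decide (p.2 = j)) :: s.tree, s.out⟩ := by
  unfold update
  cases h : μ.filter fun p => decide (p.2 = j) with
  | nil =>
    refine .inl ⟨?_, rfl⟩
    rw [List.filter_eq_nil_iff] at h
    intro hj
    obtain ⟨p, hp, rfl⟩ := List.mem_map.1 hj
    exact h p hp (by simp)
  | cons r l =>
    have hr : r ∈ μ.filter fun p => decide (p.2 = j) := by simp [h]
    obtain ⟨h1, h2⟩ := List.mem_filter.1 hr
    exact .inr ⟨r.1, by rwa [← of_decide_eq_true h2], rfl⟩

end Basic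

/-! ### The Hungarian method takes polynomial time -/

section Size

variable {α : Type}

/-- Bounds for the parts of the state after `k` steps, when the cost is less than `2 ^ t`. The dual
values are bounded crudely: a step adds at most the cost and the largest of them. -/
structure Small (nodes : List α) (t k : ℕ) (s : State α) : Prop where
  dual_length : s.dual.length ≤ nodes.length
  dual : ∀ p ∈ s.dual, p.1 ∈ nodes ∧ p.2.1 ≤ 2 ^ (2 * k + t) ∧ p.2.2 ≤ 2 ^ (2 * k + t)
  rest_length : s.rest.length ≤ nodes.length
  rest : ∀ a ∈ s.rest, a ∈ nodes
  cols_length : s.cols.length ≤ k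
  cols : ∀ a ∈ s.cols, a ∈ nodes
  tree_length : s.tree.length ≤ k + 1
  tree : ∀ e ∈ s.tree, e.1 ∈ nodes ∧ e.2.length ≤ k ∧ ∀ p ∈ e.2, p.1 ∈ nodes ∧ p.2 ∈ nodes
  out_length : s.out.length ≤ k
  out : ∀ p ∈ s.out, p.1 ∈ nodes ∧ p.2 ∈ nodes

theorem small_advance {nodes : List α} {t k : ℕ} {d : List (α × ℕ × ℕ)} {r : List α}
    {μ : List (α × α)} (hd : d.length ≤ nodes.length)
    (hd' : ∀ p ∈ d, p.1 ∈ nodes ∧ p.2.1 ≤ 2 ^ (2 * k + t) ∧ p.2.2 ≤ 2 ^ (2 * k + t))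
    (hr : r.length ≤ nodes.length) (hr' : ∀ a ∈ r, a ∈ nodes) (hμ : μ.length ≤ k)
    (hμ' : ∀ p ∈ μ, p.1 ∈ nodes ∧ p.2 ∈ nodes) : Small nodes t k (advance d r μ) := by
  cases r with
  | nil =>
    change Small nodes t k ⟨d, [], [], [], μ⟩
    exact ⟨hd, hd', by simp, by simp, by simp, by simp, by simp, by simp, hμ, hμ'⟩
  | cons a r =>
    change Small nodes t k ⟨d, r, [], [(a, μ)], μ⟩
    rw [List.length_cons] at hr
    refine ⟨hd, hd', by dsimp only; omega, fun b hb => hr' b (List.mem_cons_of_mem _ hb), by simp,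
      by simp, by simp, ?_, hμ, hμ'⟩
    rintro e (_ | ⟨_, he⟩)
    · exact ⟨hr' a (by simp), hμ, hμ'⟩
    · exact absurd he List.not_mem_nil

theorem Small.mono {nodes : List α} {t k k' : ℕ} {s : State α} (h : Small nodes t k s)
    (hk : k ≤ k') : Small nodes t k' s := by
  have hp : 2 ^ (2 * k + t) ≤ 2 ^ (2 * k' + t) := Nat.pow_le_pow_right (by simp) (by omega)
  exact ⟨h.1, fun p hp' => ⟨(h.2 p hp').1, (h.2 p hp').2.1.trans hp, (h.2 p hp').2.2.trans hp⟩,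
    h.3, h.4, h.5.trans hk, h.6, h.7.trans (by omega),
    fun e he => ⟨(h.8 e he).1, (h.8 e he).2.1.trans hk, (h.8 e he).2.2⟩, h.9.trans hk, h.10⟩

theorem small_init (nodes : List α) (t : ℕ) : Small nodes t 0 (init nodes) :=
  small_advance (by simp) (by simp +contextual) le_rfl (fun _ h => h) le_rfl (by simp)

variable [DecidableEq α]

theorem Small.step {nodes : List α} {c : α → α → ℕ} {t k : ℕ} {s : State α}
    (hc : ∀ a ∈ nodes, ∀ b ∈ nodes, c a b < 2 ^ t) (h : Small nodes t k s) :
    Small nodes t (k + 1) (step c s) := by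
  obtain ⟨-, h'⟩ | ⟨m, hm, -, h'⟩ := step_cases c s
  · rw [h']
    exact h.mono (Nat.le_succ k)
  obtain ⟨e, he, p, hp, hpe, q, hq, hqc, rfl⟩ := mem_candidates.1 hm
  have he' := h.tree e he
  have hp' := h.dual p hp
  have hq' := h.dual q hq
  have hsd : (shift s (c p.1 q.1 + q.2.2 - p.2.1)).length ≤ nodes.length := by
    simpa [shift] using h.dual_length
  have hsv : ∀ x ∈ shift s (c p.1 q.1 + q.2.2 - p.2.1), x.1 ∈ nodes ∧
      x.2.1 ≤ 2 ^ (2 * (k + 1) + t) ∧ x.2.2 ≤ 2 ^ (2 * (k + 1) + t) := by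
    intro x hx
    obtain ⟨y, hy, rfl⟩ := List.mem_map.1 hx
    have hy' := h.dual y hy
    have hcpq := hc _ hp'.1 _ hq'.1
    have h1 : 2 ^ t ≤ 2 ^ (2 * k + t) := Nat.pow_le_pow_right (by simp) (by omega)
    have h2 : 2 ^ (2 * (k + 1) + t) = 4 * 2 ^ (2 * k + t) := by
      rw [show 2 * (k + 1) + t = 2 * k + t + 2 by ring, pow_add]; ring
    refine ⟨hy'.1, ?_, ?_⟩
    · cases decide (y.1 ∈ s.tree.map fun e => e.1) <;> simp only [cond_true, cond_false] <;> omega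
    · cases decide (y.1 ∈ s.cols) <;> simp only [cond_true, cond_false] <;> omega
  rw [h']
  dsimp only
  obtain ⟨-, h''⟩ | ⟨r, hr, h''⟩ := update_cases s (c p.1 q.1 + q.2.2 - p.2.1) p.1 q.1 e.2
  · rw [h'']
    refine small_advance hsd hsv h.rest_length h.rest (by simpa using he'.2.1) ?_
    rintro x (_ | ⟨_, hx⟩)
    · exact ⟨hp'.1, hq'.1⟩
    · exact he'.2.2 x hx
  · rw [h'']
    refine ⟨hsd, hsv, h.rest_length, h.rest, by simpa using h.cols_length, ?_,
      by simpa using h.tree_length, ?_, h.out_length.trans (by omega), h.out⟩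
    · rintro x (_ | ⟨_, hx⟩)
      · exact hq'.1
      · exact h.cols x hx
    · rintro x (_ | ⟨_, hx⟩)
      · refine ⟨(he'.2.2 _ hr).1, ?_, ?_⟩
        · simp only [List.length_cons, add_le_add_iff_right]
          exact (List.length_filter_le _ _).trans he'.2.1
        · rintro x (_ | ⟨_, hx⟩)
          · exact ⟨hp'.1, hq'.1⟩
          · exact he'.2.2 x (List.mem_of_mem_filter hx)
      · have := h.tree x hx
        exact ⟨this.1, this.2.1.trans (by omega), this.2.2⟩

end Size

section PolyTime

variable {α β γ : Type} [Code α] [Code β] [Code γ]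

instance : Code (State α) := ⟨fun s => code (s.dual, s.rest, s.cols, s.tree, s.out)⟩

variable {f : γ → State α}

theorem polyTime_tuple (hf : PolyTime f) :
    PolyTime fun x => ((f x).dual, (f x).rest, (f x).cols, (f x).tree, (f x).out) :=
  .comp (f := fun s : State α => (s.dual, s.rest, s.cols, s.tree, s.out))
    (.of_prim .id (fun _ => rfl) fun _ => Nat.le_succ _) hf

@[fun_prop]
theorem polyTime_dual (hf : PolyTime f) : PolyTime fun x => (f x).dual := (polyTime_tuple hf).fst

@[fun_prop]
theorem polyTime_rest (hf : PolyTime f) : PolyTime fun x => (f x).rest :=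
  (polyTime_tuple hf).snd.fst

@[fun_prop]
theorem polyTime_cols (hf : PolyTime f) : PolyTime fun x => (f x).cols :=
  (polyTime_tuple hf).snd.snd.fst

@[fun_prop]
theorem polyTime_tree (hf : PolyTime f) : PolyTime fun x => (f x).tree :=
  (polyTime_tuple hf).snd.snd.snd.fst

@[fun_prop]
theorem polyTime_out (hf : PolyTime f) : PolyTime fun x => (f x).out :=
  (polyTime_tuple hf).snd.snd.snd.snd

@[fun_prop]
theorem polyTime_mk {f₁ : γ → List (α × ℕ × ℕ)} {f₂ f₃ : γ → List α}
    {f₄ : γ → List (α × List (α × α))} {f₅ : γ → List (α × α)} (h₁ : PolyTime f₁)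
    (h₂ : PolyTime f₂) (h₃ : PolyTime f₃) (h₄ : PolyTime f₄) (h₅ : PolyTime f₅) :
    PolyTime fun x => State.mk (f₁ x) (f₂ x) (f₃ x) (f₄ x) (f₅ x) :=
  .comp (g := fun x => (f₁ x, f₂ x, f₃ x, f₄ x, f₅ x))
    (f := fun p : _ × _ × _ × _ × _ => State.mk p.1 p.2.1 p.2.2.1 p.2.2.2.1 p.2.2.2.2)
    (.of_prim .id (fun _ => rfl) fun _ => Nat.le_succ _) (by fun_prop)

@[fun_prop]
theorem polyTime_minFst {x : γ → ℕ × β} {l : γ → List (ℕ × β)} (hx : PolyTime x)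
    (hl : PolyTime l) : PolyTime fun a => minFst (x a) (l a) := by
  obtain ⟨A, hA, -, hA'⟩ := (hx.cons hl).size_le
  refine .foldl (f := fun _ m y => bif decide (y.1 < m.1) then y else m) hl hx (by fun_prop) hA
    fun a l' hl' => ?_
  have h : minFst (x a) l' ∈ x a :: l a := by
    rcases List.mem_cons.1 (minFst_mem (x a) l') with h | h
    · simp [h]
    · exact List.mem_cons_of_mem _ (hl'.subset h)
  exact (csize_lt_of_mem h).le.trans (hA' a)

@[fun_prop]
theorem polyTime_advance {f₁ : γ → List (α × ℕ × ℕ)} {f₂ : γ → List α} {f₃ : γ → List (α × α)}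
    (h₁ : PolyTime f₁) (h₂ : PolyTime f₂) (h₃ : PolyTime f₃) :
    PolyTime fun x => advance (f₁ x) (f₂ x) (f₃ x) := by
  unfold advance
  fun_prop

theorem Small.csize_le {nodes : List α} {t k b : ℕ} {s : State α} (h : Small nodes t k s)
    (hb : ∀ a ∈ nodes, csize a ≤ b) :
    csize s ≤ 4 + (1 + nodes.length * (1 + (4 + b + 2 * (2 * k + t + 1)))) +
      (1 + nodes.length * (1 + b)) + (1 + k * (1 + b)) +
      (1 + (k + 1) * (1 + (1 + b + (1 + k * (1 + (1 + b + b)))))) +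
      (1 + k * (1 + (1 + b + b))) := by
  have hpow : ∀ {n}, n ≤ 2 ^ (2 * k + t) → Nat.size n ≤ 2 * k + t + 1 := fun hn => by
    rw [Nat.size_le]
    exact hn.trans_lt (Nat.pow_lt_pow_right (by simp) (by omega))
  have hpair : ∀ {μ : List (α × α)}, μ.length ≤ k → (∀ p ∈ μ, p.1 ∈ nodes ∧ p.2 ∈ nodes) →
      csize μ ≤ 1 + k * (1 + (1 + b + b)) := fun {μ} h1 h2 => by
    refine (csize_list_le (b := 1 + b + b) fun p hp => ?_).trans (by gcongr)
    have := hb _ (h2 p hp).1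
    have := hb _ (h2 p hp).2
    rw [csize_pair]
    omega
  have h1 : csize s.dual ≤ 1 + nodes.length * (1 + (4 + b + 2 * (2 * k + t + 1))) := by
    refine (csize_list_le (b := 4 + b + 2 * (2 * k + t + 1)) fun p hp => ?_).trans
      (by have := h.dual_length; gcongr)
    obtain ⟨h1, h2, h3⟩ := h.dual p hp
    have := hb _ h1
    have := hpow h2
    have := hpow h3
    simp only [csize_pair, csize_nat]
    omega
  have h2 : csize s.rest ≤ 1 + nodes.length * (1 + b) :=
    (csize_list_le fun a ha => hb a (h.rest a ha)).trans (by have := h.rest_length; gcongr)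
  have h3 : csize s.cols ≤ 1 + k * (1 + b) :=
    (csize_list_le fun a ha => hb a (h.cols a ha)).trans (by have := h.cols_length; gcongr)
  have h4 : csize s.tree ≤ 1 + (k + 1) * (1 + (1 + b + (1 + k * (1 + (1 + b + b))))) := by
    refine (csize_list_le (b := 1 + b + (1 + k * (1 + (1 + b + b)))) fun e he => ?_).trans
      (by have := h.tree_length; gcongr)
    obtain ⟨h1, h2, h3⟩ := h.tree e he
    have := hb _ h1
    have := hpair h2 h3
    rw [csize_pair]
    omega
  have h5 := hpair h.out_length h.out
  have h6 : csize s = 4 + csize s.dual + csize s.rest + csize s.cols + csize s.tree +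
      csize s.out := by
    change csize (s.dual, s.rest, s.cols, s.tree, s.out) = _
    simp only [csize_pair]
    omega
  omega

variable [DecidableEq α] [PolyEq α]

@[fun_prop]
theorem polyTime_shift {δ : γ → ℕ} (hf : PolyTime f) (hδ : PolyTime δ) :
    PolyTime fun x => shift (f x) (δ x) := by
  unfold shift
  fun_prop

@[fun_prop]
theorem polyTime_update {δ : γ → ℕ} {i j : γ → α} {μ : γ → List (α × α)} (hf : PolyTime f)
    (hδ : PolyTime δ) (hi : PolyTime i) (hj : PolyTime j) (hμ : PolyTime μ) :
    PolyTime fun x => update (f x) (δ x) (i x) (j x) (μ x) := by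
  unfold update
  fun_prop

variable {c : β → α → α → ℕ}

theorem polyTime_candidates (hc : PolyTime fun p : β × α × α => c p.1 p.2.1 p.2.2) {g : γ → β}
    (hg : PolyTime g) (hf : PolyTime f) : PolyTime fun x => candidates (c (g x)) (f x) := by
  unfold candidates
  have hc' : PolyTime fun p : ((γ × α × List (α × α)) × α × ℕ × ℕ) × α × ℕ × ℕ =>
      c (g p.1.1.1) p.1.2.1 p.2.1 :=
    hc.comp (g := fun p : ((γ × α × List (α × α)) × α × ℕ × ℕ) × α × ℕ × ℕ =>
      (g p.1.1.1, p.1.2.1, p.2.1)) (by fun_prop)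
  fun_prop

theorem polyTime_step (hc : PolyTime fun p : β × α × α => c p.1 p.2.1 p.2.2) {g : γ → β}
    (hg : PolyTime g) (hf : PolyTime f) : PolyTime fun x => step (c (g x)) (f x) := by
  unfold step
  have := polyTime_candidates hc hg hf
  fun_prop

theorem polyTime_matching (hc : PolyTime fun p : β × α × α => c p.1 p.2.1 p.2.2) {g : γ → β}
    (hg : PolyTime g) {l : γ → List α} (hl : PolyTime l) :
    PolyTime fun x => matching (c (g x)) (l x) := by
  obtain ⟨A, hA, hAm, hA'⟩ := hc.size_le
  obtain ⟨G, hG, -, hG'⟩ := hg.size_le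
  obtain ⟨N, hN, -, hN'⟩ := hl.size_le
  have hinit : PolyTime fun x => init (l x) := by
    unfold init
    fun_prop
  refine polyTime_out (.foldl (f := fun x s _ => step (c (g x)) s) (PolyTime.product hl hl) hinit
    (polyTime_step hc (g := fun p : γ × State α × α × α => g p.1) (by fun_prop) (by fun_prop))
    (S := fun n => 4 + (1 + N n * (1 + (4 + N n + 2 * (2 * (N n * N n) +
      A (2 + G n + N n + N n) + 1)))) +
      (1 + N n * (1 + N n)) + (1 + (N n * N n) * (1 + N n)) +
      (1 + ((N n * N n) + 1) * (1 + (1 + N n + (1 + (N n * N n) * (1 + (1 + N n + N n)))))) +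
      (1 + (N n * N n) * (1 + (1 + N n + N n)))) (by fun_prop) fun x l' hl' => ?_)
  set n := csize x
  have hNlen : (l x).length ≤ N n := (length_lt_csize _).le.trans (hN' x)
  have hNmem : ∀ a ∈ l x, csize a ≤ N n := fun a ha => (csize_lt_of_mem ha).le.trans (hN' x)
  have hcost : ∀ a ∈ l x, ∀ b ∈ l x, c (g x) a b < 2 ^ A (2 + G n + N n + N n) := by
    intro a ha b hb
    have h1 := hA' (g x, a, b)
    have h2 : A (csize (g x, a, b)) ≤ A (2 + G n + N n + N n) := by
      apply hAm
      have := hNmem a ha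
      have := hNmem b hb
      have : csize (g x) ≤ G n := hG' x
      simp only [csize_pair]
      omega
    rw [csize_nat] at h1
    dsimp only at h1
    exact Nat.size_le.1 (by omega)
  have hfold : ∀ l' : List (α × α), Small (l x) (A (2 + G n + N n + N n)) l'.length
      (l'.foldl (fun s _ => step (c (g x)) s) (init (l x))) := by
    intro l'
    induction l' using List.reverseRecOn with
    | nil => exact small_init _ _
    | append_singleton l' a ih =>
      rw [List.foldl_append, List.length_append]
      exact ih.step hcost
  have hlen : l'.length ≤ N n * N n := by
    refine hl'.length_le.trans ?_
    rw [List.length_product]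
    gcongr
  refine ((hfold l').mono hlen |>.csize_le hNmem).trans ?_
  gcongr

end PolyTime

end Hungarian

/-! ### The Hungarian method is correct -/

namespace Hungarian

variable {α : Type}

/-- The invariant of the Hungarian method, for the dual values `u` and `v`. By `closed`, the change
of the dual values cannot destroy the tightness of a matched pair; by `agree`, the matchings in the
tree differ only on its columns, so that a column outside is matched to the same row in all of them.
-/
structure Inv (c : α → α → ℕ) (nodes : List α) (u v : α → ℕ) (s : State α) : Prop where
  dual : s.dual = nodes.map fun a => (a, u a, v a)
  feasible : ∀ a ∈ nodes, ∀ b ∈ nodes, u a ≤ c a b + v b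
  out_nodup : (s.out.map Prod.snd).Nodup
  out_sub : ∀ b ∈ s.out.map Prod.snd, b ∈ nodes
  cols_nodup : s.cols.Nodup
  cols_sub : ∀ b ∈ s.cols, b ∈ s.out.map Prod.snd
  final : s.tree = [] → s.out.map Prod.fst ~ nodes ∧ ∀ p ∈ s.out, u p.1 = c p.1 p.2 + v p.2
  rows : ∀ e ∈ s.tree, e.1 :: e.2.map Prod.fst ++ s.rest ~ nodes
  columns : ∀ e ∈ s.tree, e.2.map Prod.snd ~ s.out.map Prod.snd
  tight : ∀ e ∈ s.tree, ∀ p ∈ e.2, u p.1 = c p.1 p.2 + v p.2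
  closed : ∀ e ∈ s.tree, ∀ p ∈ e.2, p.2 ∈ s.cols → p.1 ∈ s.tree.map fun e => e.1
  agree : ∀ e ∈ s.tree, ∀ e' ∈ s.tree, ∀ p ∈ e.2, p.2 ∉ s.cols → p ∈ e'.2

theorem inv_advance {c : α → α → ℕ} {nodes : List α} {u v : α → ℕ} {d : List (α × ℕ × ℕ)}
    {r : List α} {μ : List (α × α)} (hd : d = nodes.map fun a => (a, u a, v a))
    (hf : ∀ a ∈ nodes, ∀ b ∈ nodes, u a ≤ c a b + v b) (hμ : (μ.map Prod.snd).Nodup)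
    (hμ' : ∀ b ∈ μ.map Prod.snd, b ∈ nodes) (hr : μ.map Prod.fst ++ r ~ nodes)
    (ht : ∀ p ∈ μ, u p.1 = c p.1 p.2 + v p.2) : Inv c nodes u v (advance d r μ) := by
  cases r with
  | nil =>
    change Inv c nodes u v ⟨d, [], [], [], μ⟩
    exact ⟨hd, hf, hμ, hμ', by simp, by simp, fun _ => ⟨by simpa using hr, ht⟩, by simp, by simp,
      by simp, by simp, by simp⟩
  | cons a r =>
    change Inv c nodes u v ⟨d, r, [], [(a, μ)], μ⟩
    refine ⟨hd, hf, hμ, hμ', by simp, by simp, by simp, ?_, ?_, ?_, by simp, ?_⟩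
    · simp only [List.mem_singleton, forall_eq]
      exact (List.perm_middle.symm.trans hr :)
    · simp
    · simpa using ht
    · simp

theorem advance_out (d : List (α × ℕ × ℕ)) (r : List α) (μ : List (α × α)) :
    (advance d r μ).out = μ := by cases r <;> rfl

/-- A measure of progress: the matched columns count for as much as the tree can have columns. -/
def progress (nodes : List α) (s : State α) : ℕ := nodes.length * s.out.length + s.cols.length

variable [DecidableEq α]

/-- As long as there is a row left, a step keeps the invariant for new dual values and either
extends the matching or adds a column to the tree. -/
theorem Inv.step {c : α → α → ℕ} {nodes : List α} {u v : α → ℕ} {s : State α}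
    (h : Inv c nodes u v s) (hn : nodes.Nodup) (hs : s.tree ≠ []) :
    s.out.length < nodes.length ∧ s.cols.length < nodes.length ∧
    ∃ u' v', Inv c nodes u' v' (step c s) ∧ progress nodes s < progress nodes (step c s) := by
  -- the matching leaves a row exposed, so there is also a column outside the tree
  obtain ⟨e₀, he₀⟩ := List.exists_mem_of_ne_nil _ hs
  have hout : s.out.length < nodes.length := by
    have h1 := (h.rows e₀ he₀).length_eq
    have h2 := (h.columns e₀ he₀).length_eq
    simp only [List.length_append, List.length_cons, List.length_map] at h1 h2
    omega
  have hcols : s.cols.length ≤ s.out.length := by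
    simpa using (h.cols_nodup.subperm h.cols_sub).length_le
  refine ⟨hout, hcols.trans_lt hout, ?_⟩
  have hrow : ∀ e ∈ s.tree, e.1 ∈ nodes := fun e he => (h.rows e he).subset (by simp)
  have hmem : ∀ a : α, ∀ x y : ℕ, (a, x, y) ∈ s.dual ↔ a ∈ nodes ∧ x = u a ∧ y = v a := by
    intro a x y
    rw [h.dual, List.mem_map]
    constructor
    · rintro ⟨b, hb, hb'⟩
      simp only [Prod.mk.injEq] at hb'
      obtain ⟨rfl, rfl, rfl⟩ := hb'
      exact ⟨hb, rfl, rfl⟩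
    · rintro ⟨h1, rfl, rfl⟩
      exact ⟨a, h1, rfl⟩
  have hcand : ∀ m, m ∈ candidates c s ↔ ∃ e ∈ s.tree, ∃ j ∈ nodes, j ∉ s.cols ∧
      m = (c e.1 j + v j - u e.1, e.1, j, e.2) := by
    intro m
    rw [mem_candidates]
    constructor
    · rintro ⟨e, he, ⟨p, x, y⟩, hp, rfl, ⟨q, z, w⟩, hq, hqc, rfl⟩
      obtain ⟨-, rfl, rfl⟩ := (hmem _ _ _).1 hp
      obtain ⟨hqn, rfl, rfl⟩ := (hmem _ _ _).1 hq
      exact ⟨e, he, q, hqn, hqc, rfl⟩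
    · rintro ⟨e, he, j, hj, hjc, rfl⟩
      exact ⟨e, he, (e.1, u e.1, v e.1), (hmem _ _ _).2 ⟨hrow e he, rfl, rfl⟩, rfl,
        (j, u j, v j), (hmem _ _ _).2 ⟨hj, rfl, rfl⟩, hjc, rfl⟩
  obtain ⟨h0, -⟩ | ⟨m, hm, hmin, heq⟩ := step_cases c s
  · exfalso
    obtain ⟨j, hj, hjc⟩ : ∃ j ∈ nodes, j ∉ s.cols := by
      by_contra! hall
      have := (hn.subperm hall).length_le
      omega
    have := (hcand _).2 ⟨e₀, he₀, j, hj, hjc, rfl⟩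
    rw [h0] at this
    exact List.not_mem_nil this
  obtain ⟨e, he, j, hj, hjc, rfl⟩ := (hcand m).1 hm
  rw [heq]
  dsimp only
  set δ := c e.1 j + v j - u e.1 with hδ
  have hle : ∀ e' ∈ s.tree, ∀ b ∈ nodes, b ∉ s.cols → u e'.1 + δ ≤ c e'.1 b + v b := by
    intro e' he' b hb hbc
    have h1 := hmin _ ((hcand _).2 ⟨e', he', b, hb, hbc, rfl⟩)
    have h2 := h.feasible _ (hrow e' he') b hb
    dsimp only at h1
    omega
  have heqδ : u e.1 + δ = c e.1 j + v j := by
    have := h.feasible _ (hrow e he) j hj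
    omega
  -- the new dual values
  let u' : α → ℕ := fun a => if a ∈ s.tree.map fun e => e.1 then u a + δ else u a
  let v' : α → ℕ := fun a => if a ∈ s.cols then v a + δ else v a
  have hu1 : ∀ a ∈ s.tree.map fun e => e.1, u' a = u a + δ := fun a ha => if_pos ha
  have hu2 : ∀ a, a ∉ (s.tree.map fun e => e.1) → u' a = u a := fun a ha => if_neg ha
  have hv1 : ∀ a ∈ s.cols, v' a = v a + δ := fun a ha => if_pos ha
  have hv2 : ∀ a, a ∉ s.cols → v' a = v a := fun a ha => if_neg ha
  have hdual : shift s δ = nodes.map fun a => (a, u' a, v' a) := by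
    rw [shift, h.dual, List.map_map]
    refine List.map_congr_left fun a _ => ?_
    simp only [Function.comp_apply, u', v', Bool.cond_decide]
  have hle' : ∀ a ∈ s.tree.map fun e => e.1, ∀ b ∈ nodes, b ∉ s.cols → u a + δ ≤ c a b + v b := by
    intro a ha b hb hbc
    obtain ⟨e', he', rfl⟩ := List.mem_map.1 ha
    exact hle e' he' b hb hbc
  have hfeas : ∀ a ∈ nodes, ∀ b ∈ nodes, u' a ≤ c a b + v' b := by
    intro a ha b hb
    have h1 := h.feasible a ha b hb
    by_cases hat : a ∈ s.tree.map fun e => e.1 <;> by_cases hbc : b ∈ s.cols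
    · rw [hu1 a hat, hv1 b hbc]; omega
    · rw [hu1 a hat, hv2 b hbc]; exact hle' a hat b hb hbc
    · rw [hu2 a hat, hv1 b hbc]; omega
    · rw [hu2 a hat, hv2 b hbc]; omega
  have hcolsub : ∀ e' ∈ s.tree, ∀ p ∈ e'.2, p.2 ∈ nodes := fun e' he' p hp =>
    h.out_sub _ ((h.columns e' he').subset (List.mem_map_of_mem hp))
  have hrowsub : ∀ e' ∈ s.tree, ∀ p ∈ e'.2, p.1 ∈ nodes := fun e' he' p hp =>
    (h.rows e' he').subset (List.mem_append_left _
      (List.mem_cons_of_mem _ (List.mem_map_of_mem hp)))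
  -- A tight pair of a row in the tree and a column outside forces `δ = 0`.
  have htight : ∀ e' ∈ s.tree, ∀ p ∈ e'.2, u' p.1 = c p.1 p.2 + v' p.2 := by
    intro e' he' p hp
    have h1 := h.tight e' he' p hp
    by_cases hat : p.1 ∈ s.tree.map fun e => e.1 <;> by_cases hbc : p.2 ∈ s.cols
    · rw [hu1 _ hat, hv1 _ hbc]; omega
    · have := hle' _ hat _ (hcolsub e' he' p hp) hbc
      rw [hu1 _ hat, hv2 _ hbc]; omega
    · exact absurd (h.closed e' he' p hp hbc) hat
    · rw [hu2 _ hat, hv2 _ hbc]; exact h1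
  have hij : u' e.1 = c e.1 j + v' j := by
    rw [hu1 _ (List.mem_map_of_mem he), hv2 _ hjc, heqδ]
  have hnd : (e.2.map Prod.snd).Nodup := (h.columns e he).nodup_iff.2 h.out_nodup
  have hinj : ∀ {p q : α × α}, p ∈ e.2 → q ∈ e.2 → p.2 = q.2 → p = q := fun hp hq hpq =>
    List.inj_on_of_nodup_map hnd hp hq hpq
  obtain ⟨hjμ, heq'⟩ | ⟨r, hr, heq'⟩ := update_cases s δ e.1 j e.2
  · rw [heq']
    refine ⟨u', v', inv_advance hdual hfeas ?_ ?_ ?_ ?_, ?_⟩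
    · rw [List.map_cons]
      exact hnd.cons hjμ
    · rintro b hb
      rcases List.mem_cons.1 hb with rfl | hb
      · exact hj
      · exact h.out_sub b ((h.columns e he).subset hb)
    · exact h.rows e he
    · intro p hp
      rcases List.mem_cons.1 hp with rfl | hp
      · exact hij
      · exact htight e he p hp
    · have h2 := (h.columns e he).length_eq
      simp only [List.length_map] at h2
      rw [progress, progress, advance_out, List.length_cons, h2, mul_add]
      omega
  · rw [heq']
    -- the matching that leaves `r` exposed, and the one it comes from
    have hperm : e.2 ~ (r, j) :: e.2.filter fun p => !decide (p.2 = j) := by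
      have hnd' := hnd.of_map
      refine (List.perm_ext_iff_of_nodup hnd' ((hnd'.filter _).cons (by simp))).2 fun p => ?_
      simp only [List.mem_cons, List.mem_filter, Bool.not_eq_true', decide_eq_false_iff_not]
      refine ⟨fun hp => ?_, ?_⟩
      · by_cases hpj : p.2 = j
        · exact .inl (hinj hp hr hpj)
        · exact .inr ⟨hp, hpj⟩
      · rintro (rfl | ⟨hp, -⟩)
        · exact hr
        · exact hp
    have hmemtree : ∀ a, a ∈ (((r, (e.1, j) :: e.2.filter fun p => !decide (p.2 = j)) ::
        s.tree).map fun e => e.1) ↔ a = r ∨ a ∈ s.tree.map fun e => e.1 := by simp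
    -- Outside of the new set of columns, all the matchings still agree.
    have hnew : ∀ e' ∈ s.tree, ∀ p ∈ e'.2, p.2 ∉ j :: s.cols →
        p ∈ (e.1, j) :: e.2.filter fun p => !decide (p.2 = j) := by
      intro e' he' p hp hpc
      rw [List.mem_cons, not_or] at hpc
      exact List.mem_cons_of_mem _ (List.mem_filter.2 ⟨h.agree e' he' e he p hp hpc.2,
        by simpa using hpc.1⟩)
    have hsub : ∀ p ∈ (e.1, j) :: e.2.filter fun p => !decide (p.2 = j),
        p = (e.1, j) ∨ p ∈ e.2 ∧ p.2 ≠ j := by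
      intro p hp
      rcases List.mem_cons.1 hp with rfl | hp
      · exact .inl rfl
      · obtain ⟨h1, h2⟩ := List.mem_filter.1 hp
        exact .inr ⟨h1, by simpa using h2⟩
    refine ⟨u', v', ⟨hdual, hfeas, h.out_nodup, h.out_sub, h.cols_nodup.cons hjc, ?_, by simp,
      ?_, ?_, ?_, ?_, ?_⟩, ?_⟩
    · intro b hb
      rcases List.mem_cons.1 hb with rfl | hb
      · exact (h.columns e he).subset (List.mem_map_of_mem (f := Prod.snd) hr)
      · exact h.cols_sub b hb
    · intro e' he'
      rcases List.mem_cons.1 he' with rfl | he'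
      · refine .trans ?_ (h.rows e he)
        refine List.Perm.append_right _ ?_
        exact (List.Perm.swap _ _ _).trans ((hperm.map Prod.fst).symm.cons e.1)
      · exact h.rows e' he'
    · intro e' he'
      rcases List.mem_cons.1 he' with rfl | he'
      · exact (hperm.map Prod.snd).symm.trans (h.columns e he)
      · exact h.columns e' he'
    · intro e' he' p hp
      rcases List.mem_cons.1 he' with rfl | he'
      · rcases hsub p hp with rfl | ⟨hp, -⟩
        · exact hij
        · exact htight e he p hp
      · exact htight e' he' p hp
    · intro e' he' p hp hpc
      refine (hmemtree _).2 ?_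
      rcases List.mem_cons.1 he' with rfl | he'
      · rcases hsub p hp with rfl | ⟨hp, hpj⟩
        · exact .inr (List.mem_map_of_mem he)
        · exact .inr (h.closed e he p hp ((List.mem_cons.1 hpc).resolve_left hpj))
      · rcases List.mem_cons.1 hpc with hpj | hpc
        · -- both matchings give the new column to the same row
          have h1 := h.agree e' he' e he p hp (hpj ▸ hjc)
          have h2 : p = (r, j) := hinj h1 hr hpj
          exact .inl (by rw [h2])
        · exact .inr (h.closed e' he' p hp hpc)
    · intro e₁ he₁ e₂ he₂ p hp hpc
      have h1 : ∃ e' ∈ s.tree, p ∈ e'.2 := by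
        rcases List.mem_cons.1 he₁ with rfl | he₁
        · rcases hsub p hp with rfl | ⟨hp, -⟩
          · simp at hpc
          · exact ⟨e, he, hp⟩
        · exact ⟨e₁, he₁, hp⟩
      obtain ⟨e', he', hp'⟩ := h1
      rcases List.mem_cons.1 he₂ with rfl | he₂
      · exact hnew e' he' p hp' hpc
      · exact h.agree e' he' e₂ he₂ p hp' fun h => hpc (List.mem_cons_of_mem _ h)
    · simp only [progress, List.length_cons]
      omega

/-- The pairs of the matching are a permutation of the nodes, and linear programming duality
certifies that its cost is minimum. -/
theorem matching_spec (c : α → α → ℕ) {nodes : List α} (hn : nodes.Nodup) :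
    (matching c nodes).map Prod.fst ~ nodes ∧ (matching c nodes).map Prod.snd ~ nodes ∧
    ∃ u v : α → ℕ, (∀ a ∈ nodes, ∀ b ∈ nodes, u a ≤ c a b + v b) ∧
      ∀ p ∈ matching c nodes, u p.1 = c p.1 p.2 + v p.2 := by
  have key : ∀ l : List (α × α), ∃ u v,
      Inv c nodes u v (l.foldl (fun s _ => step c s) (init nodes)) ∧
      ((l.foldl (fun s _ => step c s) (init nodes)).tree = [] ∨
        l.length ≤ progress nodes (l.foldl (fun s _ => step c s) (init nodes))) := by
    intro l
    induction l using List.reverseRecOn with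
    | nil => exact ⟨fun _ => 0, fun _ => 0, inv_advance rfl (by simp) (by simp) (by simp)
        (by simp) (by simp), .inr (Nat.zero_le _)⟩
    | append_singleton l a ih =>
      obtain ⟨u, v, h1, h2⟩ := ih
      rw [List.foldl_append, List.length_append]
      set s := l.foldl (fun s _ => step c s) (init nodes)
      change ∃ u v, Inv c nodes u v (step c s) ∧
        ((step c s).tree = [] ∨ _ ≤ progress nodes (step c s))
      by_cases hs : s.tree = []
      · have : step c s = s := by simp [step, candidates, hs, listElim]
        rw [this]
        exact ⟨u, v, h1, .inl hs⟩
      · obtain ⟨-, -, u', v', h3, h4⟩ := h1.step hn hs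
        have := h2.resolve_left hs
        exact ⟨u', v', h3, .inr (by rw [List.length_singleton]; omega)⟩
  obtain ⟨u, v, h1, h2⟩ := key (nodes ×ˢ nodes)
  rw [matching]
  set s := (nodes ×ˢ nodes).foldl (fun s _ => step c s) (init nodes)
  have hs : s.tree = [] := by
    by_contra hs
    obtain ⟨h3, h4, -⟩ := h1.step hn hs
    have h5 := h2.resolve_left hs
    rw [List.length_product, progress] at h5
    have h6 := Nat.mul_le_mul_left nodes.length (Nat.succ_le_of_lt h3)
    rw [Nat.mul_succ] at h6
    omega
  obtain ⟨h3, h4⟩ := h1.final hs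
  refine ⟨h3, ?_, u, v, h1.feasible, h4⟩
  have hlen : nodes.length ≤ (s.out.map Prod.snd).length := by
    simpa using h3.length_eq.symm.le
  exact (h1.out_nodup.subperm h1.out_sub).perm_of_length_le hlen

end Hungarian

/-! ### Cutting a successor relation on time-edges into walks -/

/-- The time-edge `b` can follow the time-edge `a` in a temporal walk. -/
def link (a b : TimeEdge ℕ) : Bool := decide (a.1.2 = b.1.1) && decide (a.2 < b.2)

/-- What following `a` immediately by `b` contributes to the length or lifespan of a walk. -/
def weight (χ : Bounded) (a b : TimeEdge ℕ) : ℕ :=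
  match χ with
  | .length => 1
  | .lifespan => b.2 - a.2

/-- The cost of making `b` the successor of `a`, for the demands `ds`. If `b` cannot follow `a` in
a walk, but both are demands, then a walk ends with `a` and another one starts with `b`, at cost
`h`; a time-edge that is no demand and its own successor is not used; everything else is forbidden
by the high cost `M`. -/
def succCost (χ : Bounded) (ds : List (TimeEdge ℕ)) (h M : ℕ) (a b : TimeEdge ℕ) : ℕ :=
  bif link a b then weight χ a b else
    bif decide (a ∈ ds) && decide (b ∈ ds) then h else bif decide (a = b) then 0 else M

/-- The piece `q` of a walk can be continued from its last time-edge `a` to the time-edge `b`.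
Pieces list their time-edges in reverse order, each labelled by the total weight up to it. -/
def fits (χ : Bounded) (h : ℕ) (a b : TimeEdge ℕ) (q : List (TimeEdge ℕ × ℕ)) : Bool :=
  listElim q false fun e _ => decide (e.1 = a) && (link a b && decide (e.2 + weight χ a b < h))

/-- Continue the piece `q` to `b`. -/
def extend (χ : Bounded) (b : TimeEdge ℕ) (q : List (TimeEdge ℕ × ℕ)) : List (TimeEdge ℕ × ℕ) :=
  listElim q [] fun e _ => (b, e.2 + weight χ e.1 b) :: q

/-- Add the time-edge `b` with predecessor `a`, to the piece that ends with `a` if this is possible,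
and as a new piece otherwise. -/
def attach (χ : Bounded) (ds : List (TimeEdge ℕ)) (h : ℕ) (ps : List (List (TimeEdge ℕ × ℕ)))
    (p : TimeEdge ℕ × TimeEdge ℕ) : List (List (TimeEdge ℕ × ℕ)) :=
  bif decide (p.1 = p.2) && !decide (p.1 ∈ ds) then ps else
    listElim (ps.filter fun q => fits χ h p.1 p.2 q) ([(p.2, 0)] :: ps)
      fun q _ => extend χ p.2 q :: ps.filter fun q => !fits χ h p.1 p.2 q

/-- The pieces for a list of pairs of a time-edge and its successor, in the order of time. -/
def assemble (χ : Bounded) (ds : List (TimeEdge ℕ)) (h : ℕ)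
    (L : List (TimeEdge ℕ × TimeEdge ℕ)) : List (List (TimeEdge ℕ × ℕ)) :=
  L.foldl (attach χ ds h) []

/-- The time-vertices of a piece, up to the arrival by its last time-edge. -/
def toWalk (q : List (TimeEdge ℕ × ℕ)) : List (ℕ × ℕ) :=
  listElim q [] fun e _ => (q.reverse.map fun x => (x.1.1.1, x.1.2)) ++ [(e.1.1.2, e.1.2 + 1)]

section PolyTime

variable {γ : Type} [Code γ]

@[fun_prop]
theorem polyTime_link {f g : γ → TimeEdge ℕ} (hf : PolyTime f) (hg : PolyTime g) :
    PolyTime fun x => link (f x) (g x) := by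
  unfold link
  fun_prop

@[fun_prop]
theorem polyTime_weight (χ : Bounded) {f g : γ → TimeEdge ℕ} (hf : PolyTime f)
    (hg : PolyTime g) : PolyTime fun x => weight χ (f x) (g x) := by
  cases χ <;> unfold weight <;> fun_prop

@[fun_prop]
theorem polyTime_succCost (χ : Bounded) {ds : γ → List (TimeEdge ℕ)} {h M : γ → ℕ}
    {f g : γ → TimeEdge ℕ} (hd : PolyTime ds) (hh : PolyTime h) (hM : PolyTime M)
    (hf : PolyTime f) (hg : PolyTime g) :
    PolyTime fun x => succCost χ (ds x) (h x) (M x) (f x) (g x) := by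
  unfold succCost
  fun_prop

@[fun_prop]
theorem polyTime_fits (χ : Bounded) {h : γ → ℕ} {a b : γ → TimeEdge ℕ}
    {q : γ → List (TimeEdge ℕ × ℕ)} (hh : PolyTime h) (ha : PolyTime a) (hb : PolyTime b)
    (hq : PolyTime q) : PolyTime fun x => fits χ (h x) (a x) (b x) (q x) := by
  unfold fits
  fun_prop

@[fun_prop]
theorem polyTime_extend (χ : Bounded) {b : γ → TimeEdge ℕ} {q : γ → List (TimeEdge ℕ × ℕ)}
    (hb : PolyTime b) (hq : PolyTime q) : PolyTime fun x => extend χ (b x) (q x) := by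
  unfold extend
  fun_prop

@[fun_prop]
theorem polyTime_toWalk {q : γ → List (TimeEdge ℕ × ℕ)} (hq : PolyTime q) :
    PolyTime fun x => toWalk (q x) := by
  unfold toWalk
  fun_prop

theorem exists_of_fits {χ : Bounded} {h : ℕ} {a b : TimeEdge ℕ} {q : List (TimeEdge ℕ × ℕ)}
    (hq : fits χ h a b q = true) : ∃ y q', q = (a, y) :: q' ∧ link a b = true ∧
      y + weight χ a b < h ∧ extend χ b q = (b, y + weight χ a b) :: q := by
  cases q with
  | nil => exact absurd hq (by simp [fits, listElim])
  | cons e q =>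
    simp only [fits, listElim, Bool.and_eq_true, decide_eq_true_eq] at hq
    obtain ⟨rfl, h1, h2⟩ := hq
    exact ⟨e.2, q, rfl, h1, h2, rfl⟩

/-- A label is less than `h`, so the pieces grow by a bounded amount. -/
theorem csize_attach_le (χ : Bounded) (ds : List (TimeEdge ℕ)) (h : ℕ)
    (ps : List (List (TimeEdge ℕ × ℕ))) (p : TimeEdge ℕ × TimeEdge ℕ) :
    csize (attach χ ds h ps p) ≤ csize ps + (csize p + csize h + 10) := by
  unfold attach
  cases decide (p.1 = p.2) && !decide (p.1 ∈ ds)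
  swap
  · simp only [cond_true]; omega
  have h1 := csize_filter_add (fits χ h p.1 p.2) ps
  cases hl : ps.filter fun q => fits χ h p.1 p.2 q with
  | nil =>
    simp only [cond_false, listElim, csize_cons, csize_nil, csize_pair, csize_nat, Nat.size_zero]
    omega
  | cons q l =>
    have hq : q ∈ ps.filter fun q => fits χ h p.1 p.2 q := by simp [hl]
    obtain ⟨y, q', rfl, -, h3, h4⟩ := exists_of_fits (List.of_mem_filter hq)
    have h5 := Nat.size_le_size h3.le
    rw [hl] at h1
    simp only [cond_false, listElim, h4, csize_cons, csize_pair, csize_nat] at h1 ⊢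
    have := one_le_csize l
    omega

@[fun_prop]
theorem polyTime_assemble (χ : Bounded) {ds : γ → List (TimeEdge ℕ)} {h : γ → ℕ}
    {L : γ → List (TimeEdge ℕ × TimeEdge ℕ)} (hd : PolyTime ds) (hh : PolyTime h)
    (hL : PolyTime L) : PolyTime fun x => assemble χ (ds x) (h x) (L x) := by
  obtain ⟨A, hA, hAm, hA'⟩ := hh.size_le
  refine .foldl_of_add (f := fun x => attach χ (ds x) (h x)) hL (.const [])
    (by unfold attach; fun_prop) (S := fun n => n + A n + 10) (by fun_prop)
    (fun a b hab => ?_) fun x s p _ => ?_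
  · have := hAm hab
    exact Nat.add_le_add_right (add_le_add hab this) 10
  · have h1 := csize_attach_le χ (ds x) (h x) s p
    have h2 : csize (h x) ≤ A (csize x + csize p) := (hA' x).trans (hAm (by omega))
    omega

end PolyTime

/-- The time-edges of `q`, in reverse order, form a part of a walk that follows the pairs `L`, and
the labels are the total weights, all of them less than `h`. -/
structure IsPiece (χ : Bounded) (h : ℕ) (L : List (TimeEdge ℕ × TimeEdge ℕ))
    (q : List (TimeEdge ℕ × ℕ)) : Prop where
  chain : q.IsChain fun x y => (y.1, x.1) ∈ L ∧ link y.1 x.1 = true ∧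
    x.2 = y.2 + weight χ y.1 x.1 ∧ x.2 < h
  last : ∃ q' b, q = q' ++ [(b, 0)]

theorem IsPiece.mono {χ : Bounded} {h : ℕ} {L L' : List (TimeEdge ℕ × TimeEdge ℕ)}
    {q : List (TimeEdge ℕ × ℕ)} (hq : IsPiece χ h L q) (hL : L ⊆ L') : IsPiece χ h L' q :=
  ⟨hq.1.imp fun _ _ h => ⟨hL h.1, h.2⟩, hq.2⟩

/-- The pieces `ps` that result from the pairs `L`. The bound `potential` on their number holds for
every extension `A` of the labelling, so that in the end it can be summed up along a permutation. -/
structure Pieces (χ : Bounded) (ds : List (TimeEdge ℕ)) (h M : ℕ)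
    (L : List (TimeEdge ℕ × TimeEdge ℕ)) (ps : List (List (TimeEdge ℕ × ℕ))) : Prop where
  nodup : (ps.flatten.map Prod.fst).Nodup
  mem : ∀ b, b ∈ ps.flatten.map Prod.fst ↔ ∃ p ∈ L, p.2 = b ∧ ¬(p.1 = p.2 ∧ p.1 ∉ ds)
  piece : ∀ q ∈ ps, IsPiece χ h L q
  potential : ∀ A : TimeEdge ℕ → ℕ, (∀ x ∈ ps.flatten, A x.1 = x.2) →
    h * ps.length + (ps.flatten.map Prod.snd).sum ≤
      (L.map fun p => succCost χ ds h M p.1 p.2 + A p.1).sum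

/-- The pairs `L` of a time-edge and its successor describe a permutation of time-edges, are listed
by the time of the successor, and none of them is forbidden. -/
structure IsSucc (ds : List (TimeEdge ℕ)) (L : List (TimeEdge ℕ × TimeEdge ℕ)) : Prop where
  perm : L.map Prod.fst ~ L.map Prod.snd
  nodup : (L.map Prod.snd).Nodup
  sorted : L.Pairwise fun p p' => p.2.2 ≤ p'.2.2
  allowed : ∀ p ∈ L, link p.1 p.2 = true ∨ (p.1 ∈ ds ∧ p.2 ∈ ds) ∨ p.1 = p.2

/-- If `b` opens a new piece although it can follow `a`, then the label of `a` together with the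
weight reaches `h` and pays for the piece; otherwise the cost of the pair pays for it. -/
theorem Pieces.attach {χ : Bounded} {ds : List (TimeEdge ℕ)} {h M : ℕ}
    {L₁ L₂ : List (TimeEdge ℕ × TimeEdge ℕ)} {a b : TimeEdge ℕ}
    {ps : List (List (TimeEdge ℕ × ℕ))} (hL : IsSucc ds (L₁ ++ (a, b) :: L₂))
    (hps : Pieces χ ds h M L₁ ps) :
    Pieces χ ds h M (L₁ ++ [(a, b)]) (attach χ ds h ps (a, b)) := by
  have hnd₁ : ((L₁ ++ (a, b) :: L₂).map Prod.fst).Nodup := hL.perm.nodup_iff.2 hL.nodup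
  have hsub : L₁ ⊆ L₁ ++ [(a, b)] := by simp
  have hmem : ∀ p, p ∈ L₁ ++ [(a, b)] ↔ p ∈ L₁ ∨ p = (a, b) := by simp
  unfold TEDSC.attach
  by_cases hskip : a = b ∧ a ∉ ds
  · have : (decide (a = b) && !decide (a ∈ ds)) = true := by simpa using hskip
    rw [this, cond_true]
    refine ⟨hps.nodup, fun c => (hps.mem c).trans ?_, fun q hq => (hps.piece q hq).mono hsub,
      fun A hA => (hps.potential A hA).trans (by simp)⟩
    constructor
    · rintro ⟨p, hp, h1, h2⟩
      exact ⟨p, hsub hp, h1, h2⟩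
    · rintro ⟨p, hp, h1, h2⟩
      rcases (hmem p).1 hp with hp | rfl
      · exact ⟨p, hp, h1, h2⟩
      · exact absurd hskip h2
  have : (decide (a = b) && !decide (a ∈ ds)) = false := by simpa using hskip
  rw [this, cond_false]
  -- `b` is new
  have hb : b ∉ ps.flatten.map Prod.fst := by
    rw [hps.mem]
    rintro ⟨p, hp, rfl, -⟩
    have h1 := hL.nodup
    rw [List.map_append, List.map_cons, List.nodup_middle, List.nodup_cons] at h1
    exact h1.1 (List.mem_append_left _ (List.mem_map.2 ⟨_, hp, rfl⟩))
  have hmem' : ∀ {c : TimeEdge ℕ} {x : Prop}, (x ↔ ∃ p ∈ L₁, p.2 = c ∧ ¬(p.1 = p.2 ∧ p.1 ∉ ds)) →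
      ((c = b ∨ x) ↔ ∃ p ∈ L₁ ++ [(a, b)], p.2 = c ∧ ¬(p.1 = p.2 ∧ p.1 ∉ ds)) := by
    intro c x hx
    rw [hx]
    constructor
    · rintro (rfl | ⟨p, hp, h1, h2⟩)
      · exact ⟨(a, c), by simp, rfl, hskip⟩
      · exact ⟨p, hsub hp, h1, h2⟩
    · rintro ⟨p, hp, h1, h2⟩
      rcases (hmem p).1 hp with hp | rfl
      · exact .inr ⟨p, hp, h1, h2⟩
      · exact .inl h1.symm
  cases hl : ps.filter fun q => fits χ h a b q with
  | cons q l =>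
    have hq : q ∈ ps.filter fun q => fits χ h a b q := by simp [hl]
    obtain ⟨y, q', hqe, hlink, hlt, hext⟩ := exists_of_fits (List.of_mem_filter hq)
    have hqps := List.mem_of_mem_filter hq
    -- `q` is the only piece that contains `a`
    have hperm : ps ~ q :: ps.filter fun q => !fits χ h a b q := by
      have h1 := (List.filter_append_perm (fits χ h a b) ps).symm
      rw [hl] at h1
      cases l with
      | nil => exact h1
      | cons q₂ l =>
        exfalso
        have hq₂ : q₂ ∈ ps.filter fun q => fits χ h a b q := by simp [hl]
        obtain ⟨y₂, q₂', rfl, -⟩ := exists_of_fits (List.of_mem_filter hq₂)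
        have h2 := (h1.flatten.map Prod.fst).nodup_iff.1 hps.nodup
        subst hqe
        simp at h2
    have hperm' := hperm.flatten
    rw [List.flatten_cons] at hperm'
    simp only [listElim, hext]
    have hflat : ∀ z : List (List (TimeEdge ℕ × ℕ)), (((b, y + weight χ a b) :: q) :: z).flatten =
      (b, y + weight χ a b) :: (q ++ z.flatten) := fun z => rfl
    have hbcost : succCost χ ds h M a b = weight χ a b := by simp [succCost, hlink]
    refine ⟨?_, fun c => ?_, ?_, fun A hA => ?_⟩
    · rw [hflat, List.map_cons, ((hperm'.map Prod.fst).symm.cons b).nodup_iff]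
      exact hps.nodup.cons hb
    · rw [hflat, List.map_cons, ((hperm'.map Prod.fst).symm.cons b).mem_iff, List.mem_cons]
      exact hmem' (hps.mem c)
    · intro r hr
      rcases List.mem_cons.1 hr with rfl | hr
      · obtain ⟨h1, q'', z, h2⟩ := (hps.piece q hqps).mono hsub
        refine ⟨?_, (b, y + weight χ a b) :: q'', z, by rw [h2]; rfl⟩
        rw [hqe] at h1 ⊢
        exact .cons_cons ⟨by simp, hlink, rfl, hlt⟩ h1
      · exact (hps.piece r (List.mem_of_mem_filter hr)).mono hsub
    · rw [hflat] at hA ⊢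
      have hA' : ∀ x ∈ ps.flatten, A x.1 = x.2 := fun x hx =>
        hA x (List.mem_cons_of_mem _ (hperm'.subset hx))
      have h1 := hps.potential A hA'
      have h2 : A a = y := hA' (a, y) (List.mem_flatten_of_mem hqps (by simp [hqe]))
      have h3 := (hperm'.map Prod.snd).sum_eq
      rw [h3] at h1
      have h4 := hperm.length_eq
      rw [List.length_cons] at h4
      simp only [List.map_cons, List.sum_cons, List.length_cons, ← h4, List.map_append,
        List.sum_append, hbcost, h2, List.map_nil, List.sum_nil] at h1 ⊢
      omega
  | nil =>
    have hflat : ([(b, 0)] :: ps).flatten = (b, 0) :: ps.flatten := rfl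
    refine ⟨?_, fun c => ?_, ?_, fun A hA => ?_⟩
    · rw [listElim, hflat, List.map_cons]
      exact hps.nodup.cons hb
    · rw [listElim, hflat, List.map_cons, List.mem_cons]
      exact hmem' (hps.mem c)
    · intro r hr
      rcases List.mem_cons.1 hr with rfl | hr
      · exact ⟨.singleton _, [], b, rfl⟩
      · exact (hps.piece r hr).mono hsub
    · rw [listElim, hflat] at hA ⊢
      have hA' : ∀ x ∈ ps.flatten, A x.1 = x.2 := fun x hx => hA x (List.mem_cons_of_mem _ hx)
      have h1 := hps.potential A hA'
      suffices h2 : h ≤ succCost χ ds h M a b + A a by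
        simp only [List.map_cons, List.sum_cons, List.length_cons, List.map_append,
          List.sum_append, List.map_nil, List.sum_nil, mul_add] at h1 ⊢
        omega
      by_cases hlink : link a b = true
      · have hbcost : succCost χ ds h M a b = weight χ a b := by simp [succCost, hlink]
        have htime : a.2 < b.2 := by
          simp only [link, Bool.and_eq_true, decide_eq_true_eq] at hlink
          exact hlink.2
        -- `a` precedes `b`, and it is used
        have ha : a ∈ ps.flatten.map Prod.fst := by
          rw [hps.mem]
          have h2 : a ∈ (L₁ ++ (a, b) :: L₂).map Prod.snd :=
            hL.perm.subset (List.mem_map.2 ⟨(a, b), by simp, rfl⟩)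
          obtain ⟨p, hp, hpa⟩ := List.mem_map.1 h2
          refine ⟨p, ?_, hpa, ?_⟩
          · rcases List.mem_append.1 hp with hp | hp
            · exact hp
            · exfalso
              rcases List.mem_cons.1 hp with rfl | hp
              · exact htime.ne (congrArg Prod.snd hpa).symm
              · have h3 := (List.pairwise_append.1 hL.sorted).2.1
                have h4 := (List.pairwise_cons.1 h3).1 p hp
                rw [hpa] at h4
                exact absurd htime (not_lt.2 h4)
          · rintro ⟨h3, -⟩
            have h4 : p = (a, b) := List.inj_on_of_nodup_map hnd₁ hp (by simp) (h3.trans hpa)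
            rw [h4] at h3
            exact htime.ne (congrArg Prod.snd h3)
        obtain ⟨x, hx, hxa⟩ := List.mem_map.1 ha
        obtain ⟨q, hq, hxq⟩ := List.mem_flatten.1 hx
        obtain ⟨q₁, q₂, rfl⟩ := List.append_of_mem hxq
        -- and its piece ends with it, since its successor is new
        have hq₁ : q₁ = [] := by
          by_contra hne
          obtain ⟨q₃, z, rfl⟩ : ∃ q₃ z, q₁ = q₃ ++ [z] :=
            ⟨_, _, (List.dropLast_append_getLast hne).symm⟩
          have h2 := (hps.piece _ hq).chain
          rw [List.append_assoc] at h2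
          have h3 := (List.isChain_append.1 h2).2.1
          have h4 := (List.isChain_cons_cons.1 h3).1.1
          rw [hxa] at h4
          rw [List.map_append, List.map_cons, List.nodup_middle, List.nodup_cons] at hnd₁
          exact hnd₁.1 (List.mem_append_left _ (List.mem_map.2 ⟨_, h4, rfl⟩))
        subst hq₁
        have h2 : ¬ (fits χ h a b (x :: q₂) = true) := fun h3 => by
          have h4 : (x :: q₂) ∈ ps.filter fun q => fits χ h a b q := List.mem_filter.2 ⟨hq, h3⟩
          rw [hl] at h4
          exact List.not_mem_nil h4
        simp only [fits, listElim, hxa, hlink, decide_true, Bool.true_and, decide_eq_true_eq,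
          not_lt] at h2
        have h3 := hA' x hx
        rw [hxa] at h3
        omega
      · have h2 : a ∈ ds ∧ b ∈ ds := by
          have h3 := ((hL.allowed (a, b) (by simp)).resolve_left hlink)
          rcases h3 with h3 | h3
          · exact h3
          · dsimp only at h3
            subst h3
            have : a ∈ ds := by_contra fun h4 => hskip ⟨rfl, h4⟩
            exact ⟨this, this⟩
        simp [succCost, hlink, h2]

theorem pieces_assemble {χ : Bounded} {ds : List (TimeEdge ℕ)} {h : ℕ} (M : ℕ)
    {L : List (TimeEdge ℕ × TimeEdge ℕ)} (hL : IsSucc ds L) :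
    Pieces χ ds h M L (assemble χ ds h L) := by
  have key : ∀ L₁ L₂, L₁ ++ L₂ = L → Pieces χ ds h M L₁ (assemble χ ds h L₁) := by
    intro L₁
    induction L₁ using List.reverseRecOn with
    | nil => exact fun L₂ _ => ⟨by simp [assemble], by simp [assemble], by simp [assemble],
        fun A _ => by simp [assemble]⟩
    | append_singleton L₁ p ih =>
      intro L₂ e
      rw [List.append_assoc] at e
      rw [assemble, List.foldl_append]
      exact Pieces.attach (L₂ := L₂) (e ▸ hL) (ih _ e)
  exact key L [] (by simp)

/-- As the successor relation is a permutation, the labels cancel in the sum of the potentials. -/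
theorem Pieces.mul_length_le {χ : Bounded} {ds : List (TimeEdge ℕ)} {h M : ℕ}
    {L : List (TimeEdge ℕ × TimeEdge ℕ)} {ps : List (List (TimeEdge ℕ × ℕ))}
    (hL : IsSucc ds L) (hps : Pieces χ ds h M L ps) :
    h * ps.length ≤ (L.map fun p => succCost χ ds h M p.1 p.2).sum := by
  classical
  let A : TimeEdge ℕ → ℕ := fun b => if hb : ∃ x ∈ ps.flatten, x.1 = b then hb.choose.2 else 0
  have hA : ∀ x ∈ ps.flatten, A x.1 = x.2 := by
    intro x hx
    have hb : ∃ y ∈ ps.flatten, y.1 = x.1 := ⟨x, hx, rfl⟩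
    have h1 : A x.1 = hb.choose.2 := dif_pos hb
    rw [h1, List.inj_on_of_nodup_map hps.nodup hb.choose_spec.1 hx hb.choose_spec.2]
  have hA0 : ∀ b, b ∉ ps.flatten.map Prod.fst → A b = 0 := by
    intro b hb
    exact dif_neg fun ⟨x, hx, h⟩ => hb (List.mem_map.2 ⟨x, hx, h⟩)
  have h1 := hps.potential A hA
  have h2 : (L.map fun p => A p.1).sum = (ps.flatten.map Prod.snd).sum := by
    have h3 : (L.map fun p => A p.1) = (L.map Prod.fst).map A := by simp
    have h4 : ps.flatten.map Prod.snd = (ps.flatten.map Prod.fst).map A := by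
      rw [List.map_map]
      exact List.map_congr_left fun x hx => (hA x hx).symm
    rw [h3, h4, (hL.perm.map A).sum_eq, ← List.sum_toFinset A hL.nodup,
      ← List.sum_toFinset A hps.nodup]
    refine (Finset.sum_subset (fun b hb => ?_) fun b _ hb => hA0 b (by simpa using hb)).symm
    rw [List.mem_toFinset] at hb ⊢
    obtain ⟨p, hp, rfl, -⟩ := (hps.mem b).1 hb
    exact List.mem_map_of_mem hp
  rw [List.sum_map_add, h2] at h1
  omega

/-! ### The walk of a piece -/

section Walk

theorem walkEdges_append_pair {V : Type*} (l : List (V × ℕ)) (u v : V × ℕ) :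
    walkEdges (l ++ [u] ++ [v]) = walkEdges (l ++ [u]) ++ [((u.1, v.1), u.2)] := by
  induction l with
  | nil => rfl
  | cons a l ih =>
    cases l with
    | nil => rfl
    | cons b l =>
      simp only [walkEdges, List.cons_append, List.tail_cons, List.zipWith_cons_cons] at ih ⊢
      rw [ih]

variable {χ : Bounded} {h : ℕ} {L : List (TimeEdge ℕ × TimeEdge ℕ)} {q : List (TimeEdge ℕ × ℕ)}

theorem IsPiece.walkEdges_toWalk (hq : IsPiece χ h L q) :
    walkEdges (toWalk q) = (q.map Prod.fst).reverse := by
  have key : ∀ (e : TimeEdge ℕ × ℕ) (q : List (TimeEdge ℕ × ℕ)) (s : ℕ),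
      (e :: q).IsChain (fun x y => link y.1 x.1 = true) →
      walkEdges (((e :: q).reverse.map fun x => (x.1.1.1, x.1.2)) ++ [(e.1.1.2, s)]) =
        ((e :: q).map Prod.fst).reverse := by
    intro e q
    induction q generalizing e with
    | nil => intro s _; rfl
    | cons y q ih =>
      intro s hc
      obtain ⟨h1, h2⟩ := List.isChain_cons_cons.1 hc
      simp only [link, Bool.and_eq_true, decide_eq_true_eq] at h1
      have h3 := ih y e.1.2 h2
      rw [h1.1] at h3
      rw [List.reverse_cons, List.map_append, List.map_singleton, walkEdges_append_pair, h3]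
      simp
  obtain ⟨q', b, hq'⟩ := hq.last
  cases q with
  | nil => simp at hq'
  | cons e q => exact key e q _ (hq.chain.imp fun _ _ h => h.2.1)

theorem IsPiece.isChain_toWalk (hq : IsPiece χ h L q) :
    ((toWalk q).map Prod.snd).IsChain (· < ·) := by
  cases q with
  | nil => exact .nil
  | cons e q =>
    have h1 : (toWalk (e :: q)).map Prod.snd =
        ((e.1.2 + 1) :: (e :: q).map fun x => x.1.2).reverse := by
      simp [toWalk, listElim, Function.comp_def]
    rw [h1, List.isChain_reverse]
    refine .cons_cons (Nat.lt_succ_self _) ?_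
    have h2 : ((e :: q).map fun x => x.1.2).IsChain fun a b => b < a := by
      rw [List.isChain_map]
      refine hq.chain.imp fun x y h => ?_
      have h3 := h.2.1
      simp only [link, Bool.and_eq_true, decide_eq_true_eq] at h3
      exact h3.2
    exact h2

theorem walkLifespan_eq {V : Type*} (p : List (V × ℕ)) (a b : V × ℕ) (l l' : List (V × ℕ))
    (ha : p = a :: l) (hb : p = l' ++ [b]) : walkLifespan p = b.2 - a.2 := by
  subst ha
  rw [walkLifespan]
  congr 2
  simp [hb]

theorem IsPiece.cost_toWalk_le (hq : IsPiece χ h L q) (hh : 1 ≤ h) : χ.cost (toWalk q) ≤ h := by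
  obtain ⟨q', b, rfl⟩ := hq.last
  -- the label of the last time-edge is one less than the length or lifespan
  have key : ∀ q' : List (TimeEdge ℕ × ℕ), (q' ++ [(b, 0)]).IsChain (fun x y : TimeEdge ℕ × ℕ =>
      (y.1, x.1) ∈ L ∧ link y.1 x.1 = true ∧ x.2 = y.2 + weight χ y.1 x.1 ∧ x.2 < h) →
      ∃ x l, q' ++ [(b, 0)] = x :: l ∧ x.2 < h ∧ match χ with
        | .length => x.2 = q'.length
        | .lifespan => x.1.2 = x.2 + b.2 := by
    intro q'
    induction q' with
    | nil => exact fun _ => ⟨(b, 0), [], rfl, hh, by cases χ <;> simp⟩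
    | cons e q' ih =>
      intro hc
      obtain ⟨x, l, h1, -, h3⟩ := ih hc.of_cons
      rw [List.cons_append, h1] at hc
      obtain ⟨-, h5, h6, h7⟩ := (List.isChain_cons_cons.1 hc).1
      simp only [link, Bool.and_eq_true, decide_eq_true_eq] at h5
      refine ⟨e, x :: l, by rw [List.cons_append, h1], h7, ?_⟩
      cases χ
      · simp only [weight] at h6 h3 ⊢
        simp only [List.length_cons]
        omega
      · simp only [weight] at h6 h3 ⊢
        omega
  obtain ⟨x, l, h1, h2, h3⟩ := key q' hq.chain
  cases χ
  · simp only [Bounded.cost, walkLength, hq.walkEdges_toWalk, List.length_reverse,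
      List.length_map, List.length_append, List.length_singleton] at h3 ⊢
    omega
  · have h4 : toWalk (q' ++ [(b, 0)]) = (b.1.1, b.2) ::
        ((q'.reverse.map fun x => (x.1.1.1, x.1.2)) ++ [(x.1.1.2, x.1.2 + 1)]) := by
      have : toWalk (x :: l) = ((x :: l).reverse.map fun x => (x.1.1.1, x.1.2)) ++
        [(x.1.1.2, x.1.2 + 1)] := rfl
      rw [h1, this, ← h1]
      simp
    simp only [Bounded.cost] at h3 ⊢
    rw [walkLifespan_eq _ _ (x.1.1.2, x.1.2 + 1) _ (((b.1.1, b.2) ::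
        (q'.reverse.map fun x => (x.1.1.1, x.1.2)))) h4 (by rw [h4]; simp)]
    dsimp only
    omega

end Walk

/-! ### Schedules as lists of time-edges -/

/-- The total weight of a list of time-edges that follow each other. -/
def pathWeight (χ : Bounded) : List (TimeEdge ℕ) → ℕ
  | [] => 0
  | [_] => 0
  | a :: b :: l => weight χ a b + pathWeight χ (b :: l)

/-- The lists `W` of time-edges satisfying `P` are the walks of a schedule that extends `ds`. Empty
lists are permitted. -/
structure IsCover (P : TimeEdge ℕ → Prop) (ds : List (TimeEdge ℕ))
    (W : List (List (TimeEdge ℕ))) : Prop where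
  chain : ∀ l ∈ W, l.IsChain fun a b => link a b = true
  nodup : W.flatten.Nodup
  mem : ∀ e ∈ W.flatten, P e
  covers : ∀ d ∈ ds, d ∈ W.flatten

/-- Every nonempty list of `W` begins and ends with a demand. -/
def Trimmed (ds : List (TimeEdge ℕ)) (W : List (List (TimeEdge ℕ))) : Prop :=
  ∀ l ∈ W, (∀ a l', l = a :: l' → a ∈ ds) ∧ ∀ a l', l = l' ++ [a] → a ∈ ds

/-- The cost of a schedule: `h` for every walk, plus the weights. -/
def coverCost (χ : Bounded) (h : ℕ) (W : List (List (TimeEdge ℕ))) : ℕ :=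
  (W.map fun l => h + pathWeight χ l).sum

theorem link_iff {a b : TimeEdge ℕ} : link a b = true ↔ a.1.2 = b.1.1 ∧ a.2 < b.2 := by
  simp [link]

/-- The triangle inequality. -/
theorem weight_le_add (χ : Bounded) (a b c : TimeEdge ℕ) :
    weight χ a c ≤ weight χ a b + weight χ b c := by
  cases χ <;> simp only [weight] <;> omega

theorem pathWeight_remove (χ : Bounded) (x : List (TimeEdge ℕ)) (c : TimeEdge ℕ)
    (y : List (TimeEdge ℕ)) : pathWeight χ (x ++ y) ≤ pathWeight χ (x ++ c :: y) := by
  induction x with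
  | nil => cases y <;> simp [pathWeight]
  | cons a x ih =>
    cases x with
    | nil =>
      cases y with
      | nil => simp [pathWeight]
      | cons d y =>
        have := weight_le_add χ a c d
        simp only [List.cons_append, List.nil_append, pathWeight]
        omega
    | cons b x =>
      simp only [List.cons_append, pathWeight] at ih ⊢
      omega

theorem pathWeight_le_of_sublist (χ : Bounded) {l l' : List (TimeEdge ℕ)} (h : l' <+ l) :
    pathWeight χ l' ≤ pathWeight χ l := by
  suffices H : ∀ x, pathWeight χ (x ++ l') ≤ pathWeight χ (x ++ l) from H []
  induction h with
  | slnil => exact fun _ => le_rfl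
  | cons a _ ih => exact fun x => (ih x).trans (pathWeight_remove χ x a _)
  | cons_cons a _ ih =>
    intro x
    simpa using ih (x ++ [a])

theorem pairwise_time_lt {l : List (TimeEdge ℕ)} (h : l.IsChain fun a b => link a b = true) :
    l.Pairwise fun a b => a.2 < b.2 := by
  have h1 : l.IsChain fun a b => a.2 < b.2 := h.imp fun a b h => (link_iff.1 h).2
  have : IsTrans (TimeEdge ℕ) fun a b => a.2 < b.2 := ⟨fun _ _ _ => lt_trans⟩
  exact List.isChain_iff_pairwise.1 h1

theorem pathWeight_length {a : TimeEdge ℕ} {l : List (TimeEdge ℕ)} :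
    pathWeight .length (a :: l) = l.length := by
  induction l generalizing a with
  | nil => rfl
  | cons b l ih => rw [pathWeight, ih, List.length_cons, weight, add_comm]

/-- The weights telescope to the time between the first and the last time-edge. -/
theorem pathWeight_lifespan {a : TimeEdge ℕ} {l : List (TimeEdge ℕ)}
    (h : (a :: l).IsChain fun a b => link a b = true) :
    pathWeight .lifespan (a :: l) + a.2 = ((a :: l).getLast (List.cons_ne_nil a l)).2 := by
  induction l generalizing a with
  | nil => simp [pathWeight]
  | cons b l ih =>
    obtain ⟨h1, h2⟩ := List.isChain_cons_cons.1 h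
    have := (link_iff.1 h1).2
    rw [List.getLast_cons_cons, ← ih h2]
    simp only [pathWeight, weight]
    omega

section Duality

variable {χ : Bounded} {ds : List (TimeEdge ℕ)} {h M : ℕ} {u v : TimeEdge ℕ → ℕ}

theorem sum_add_le_of_chain {a : TimeEdge ℕ} {l : List (TimeEdge ℕ)}
    (hl : (a :: l).IsChain fun a b => link a b = true)
    (huv : ∀ a' ∈ a :: l, ∀ b ∈ a :: l, u a' ≤ succCost χ ds h M a' b + v b) :
    ((a :: l).map u).sum + v a ≤
      pathWeight χ (a :: l) + u ((a :: l).getLast (List.cons_ne_nil a l)) +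
        ((a :: l).map v).sum := by
  induction l generalizing a with
  | nil => simp [pathWeight]
  | cons b l ih =>
    obtain ⟨h1, h2⟩ := List.isChain_cons_cons.1 hl
    have h3 := ih h2 fun a' ha' b' hb' =>
      huv a' (List.mem_cons_of_mem _ ha') b' (List.mem_cons_of_mem _ hb')
    have h4 := huv a (by simp) b (by simp)
    simp only [succCost, h1, cond_true] at h4
    rw [List.getLast_cons_cons]
    simp only [List.map_cons, List.sum_cons, pathWeight] at h3 ⊢
    omega

/-- Closing up each walk from its last to its first time-edge turns a trimmed schedule into a
permutation of the nodes, so feasible dual values bound its cost from below. -/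
theorem sum_le_coverCost {nodes : List (TimeEdge ℕ)} (hn : nodes.Nodup)
    {W : List (List (TimeEdge ℕ))} (hW : IsCover (· ∈ nodes) ds W) (ht : Trimmed ds W)
    (huv : ∀ a ∈ nodes, ∀ b ∈ nodes, u a ≤ succCost χ ds h M a b + v b) :
    (nodes.map u).sum ≤ coverCost χ h W + (nodes.map v).sum := by
  have hperm : nodes ~ W.flatten ++ nodes.filter fun a => a ∉ W.flatten := by
    refine (List.perm_ext_iff_of_nodup hn ?_).2 fun a => ?_
    · refine hW.nodup.append (hn.filter _) fun a ha ha' => ?_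
      exact of_decide_eq_true (List.mem_filter.1 ha').2 ha
    · simp only [List.mem_append, List.mem_filter, decide_eq_true_eq]
      have := hW.mem a
      tauto
  have hunused : ((nodes.filter fun a => a ∉ W.flatten).map u).sum ≤
      ((nodes.filter fun a => a ∉ W.flatten).map v).sum := by
    refine List.sum_le_sum fun a ha => ?_
    obtain ⟨h1, h2⟩ := List.mem_filter.1 ha
    have h3 := huv a h1 a h1
    have h4 : a ∉ ds := fun h => of_decide_eq_true h2 (hW.covers a h)
    have h5 : link a a = false := by
      rw [← Bool.not_eq_true, link_iff]
      exact fun h => lt_irrefl _ h.2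
    simpa [succCost, h4, h5] using h3
  have hused : (W.flatten.map u).sum ≤ coverCost χ h W + (W.flatten.map v).sum := by
    have key : ∀ l ∈ W, (l.map u).sum ≤ h + pathWeight χ l + (l.map v).sum := by
      intro l hl
      cases hla : l with
      | nil => simp
      | cons a l' =>
        subst hla
        have hmem : ∀ x ∈ a :: l', x ∈ nodes := fun x hx =>
          hW.mem x (List.mem_flatten_of_mem hl hx)
        have h1 := sum_add_le_of_chain (hW.chain _ hl) fun x hx y hy =>
          huv x (hmem x hx) y (hmem y hy)
        set z := (a :: l').getLast (List.cons_ne_nil a l')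
        have hz : z ∈ a :: l' := List.getLast_mem _
        have h2 := huv z (hmem z hz) a (hmem a (by simp))
        have h3 : z ∈ ds := (ht _ hl).2 z _ (List.dropLast_append_getLast _).symm
        have h4 : a ∈ ds := (ht _ hl).1 a l' rfl
        have h5 : link z a = false := by
          rw [← Bool.not_eq_true, link_iff]
          rintro ⟨-, h⟩
          rcases List.mem_cons.1 hz with h6 | h6
          · rw [h6] at h; exact lt_irrefl _ h
          · exact lt_asymm h ((List.pairwise_cons.1 (pairwise_time_lt (hW.chain _ hl))).1 z h6)
        simp only [succCost, h3, h4, h5, cond_false, decide_true, Bool.and_self, cond_true] at h2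
        omega
    have hsum : ∀ W' : List (List (TimeEdge ℕ)), (∀ l ∈ W', l ∈ W) →
        (W'.flatten.map u).sum ≤ coverCost χ h W' + (W'.flatten.map v).sum := by
      intro W' hW'
      induction W' with
      | nil => simp [coverCost]
      | cons l W' ih =>
        have h1 := key l (hW' l (by simp))
        have h2 := ih fun l hl => hW' l (List.mem_cons_of_mem _ hl)
        simp only [List.flatten_cons, List.map_append, List.sum_append, coverCost, List.map_cons,
          List.sum_cons] at h2 ⊢
        omega
    exact hsum W fun _ h => h
  have h1 := (hperm.map u).sum_eq
  have h2 := (hperm.map v).sum_eq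
  rw [List.map_append, List.sum_append] at h1 h2
  omega

end Duality

/-! ### Schedules with few time-edges -/

theorem pairwise_of_splits {α : Type*} {R : α → α → Prop} {l : List α}
    (h : ∀ x a y b z, l = x ++ a :: y ++ b :: z → R a b) : l.Pairwise R := by
  induction l with
  | nil => exact .nil
  | cons a l ih =>
    refine List.pairwise_cons.2 ⟨fun b hb => ?_,
      ih fun x c y d z e => h (a :: x) c y d z (by simp [e])⟩
    obtain ⟨y, z, rfl⟩ := List.append_of_mem hb
    exact h [] a y b z rfl

/-- If every element with `p` has at most `n - 1` elements without `p` immediately before it, and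
the last element has `p`, then at least one element in `n` has `p`. -/
theorem length_le_mul_countP {α : Type*} (p : α → Bool) (n : ℕ) (l : List α)
    (hn : ∀ x c d y, l = x ++ (c ++ [d]) ++ y → (∀ e ∈ c, p e = false) → c.length + 1 ≤ n)
    (hlast : ∀ a l', l = l' ++ [a] → p a = true) : l.length ≤ n * l.countP p := by
  induction hlen : l.length using Nat.strong_induction_on generalizing l with
  | _ k ih =>
    subst hlen
    have hsplit := List.takeWhile_append_dropWhile (p := fun e => !p e) (l := l)
    have htw : ∀ e ∈ l.takeWhile fun e => !p e, p e = false := fun e he => by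
      simpa using List.mem_takeWhile_imp he
    set c := l.takeWhile fun e => !p e
    cases hd : l.dropWhile fun e => !p e with
    | nil =>
      rw [hd, List.append_nil] at hsplit
      rcases List.eq_nil_or_concat l with h0 | ⟨l', a, h0⟩
      · simp [h0]
      · rw [List.concat_eq_append] at h0
        have h1 := hlast a l' h0
        have h2 := htw a (by rw [hsplit, h0]; simp)
        rw [h1] at h2
        exact absurd h2 (by simp)
    | cons d y =>
      rw [hd] at hsplit
      have hpd : p d = true := by
        have := List.head_dropWhile_not (fun e => !p e) (l := l) (by simp [hd])
        simpa [hd] using this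
      have h1 := hn [] c d y (by simp [← hsplit]) htw
      have h2 : y.length ≤ n * y.countP p := by
        refine ih _ (by rw [← hsplit]; simp; omega) y (fun x c' d' y' e => ?_)
          (fun a l' e => ?_) rfl
        · exact hn (c ++ d :: x) c' d' y' (by rw [← hsplit, e]; simp)
        · exact hlast a (c ++ d :: l') (by rw [← hsplit, e]; simp)
      rw [← hsplit]
      simp only [List.length_append, List.length_cons, List.countP_append, List.countP_cons, hpd,
        if_true, mul_add]
      omega

section Minimal

variable {P : TimeEdge ℕ → Prop} {ds : List (TimeEdge ℕ)} {W : List (List (TimeEdge ℕ))}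
  {χ : Bounded} {h n : ℕ}

/-- Among the schedules that cost no more than a given one, one with the fewest time-edges is
trimmed, and never visits a vertex twice between two demands, as walks may wait. -/
theorem exists_short_cover (hn : ∀ e, P e → e.1.1 < n) (hW : IsCover P ds W) :
    ∃ W', IsCover P ds W' ∧ coverCost χ h W' ≤ coverCost χ h W ∧ Trimmed ds W' ∧
      W'.flatten.length ≤ n * ds.length := by
  obtain ⟨W', ⟨hW', hc⟩, hmin⟩ := (measure fun W : List (List (TimeEdge ℕ)) =>
    W.flatten.length).wf.has_min {W' | IsCover P ds W' ∧ coverCost χ h W' ≤ coverCost χ h W}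
      ⟨W, hW, le_rfl⟩
  -- No part without demands can be cut out.
  have key : ∀ l ∈ W', ∀ x c y, l = x ++ c ++ y → (∀ e ∈ c, e ∉ ds) →
      (x ++ y).IsChain (fun a b => link a b = true) → c = [] := by
    intro l hl x c y e hcd hch
    by_contra hne
    obtain ⟨W₁, W₂, rfl⟩ := List.append_of_mem hl
    have hsub : x ++ y <+ l := by
      rw [e, List.append_assoc]
      exact (List.sublist_append_right c y).append_left x
    have hsub' : (W₁ ++ (x ++ y) :: W₂).flatten <+ (W₁ ++ l :: W₂).flatten := by
      simp only [List.flatten_append, List.flatten_cons]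
      exact (hsub.append_right _).append_left _
    refine hmin (W₁ ++ (x ++ y) :: W₂) ⟨⟨?_, hW'.nodup.sublist hsub', fun e he =>
      hW'.mem e (hsub'.subset he), fun d hd => ?_⟩, ?_⟩ ?_
    · intro l' hl'
      rcases List.mem_append.1 hl' with h1 | h1
      · exact hW'.chain l' (by simp [h1])
      · rcases List.mem_cons.1 h1 with rfl | h1
        · exact hch
        · exact hW'.chain l' (by simp [h1])
    · have h1 := hW'.covers d hd
      have h2 := fun h : d ∈ c => hcd d h hd
      simp only [e, List.flatten_append, List.flatten_cons, List.mem_append] at h1 ⊢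
      tauto
    · refine le_trans ?_ hc
      have := pathWeight_le_of_sublist χ hsub
      simp only [coverCost, List.map_append, List.map_cons, List.sum_append, List.sum_cons]
      omega
    · have h1 := List.length_pos_of_ne_nil hne
      change (W₁ ++ (x ++ y) :: W₂).flatten.length < (W₁ ++ l :: W₂).flatten.length
      simp only [e, List.flatten_append, List.flatten_cons, List.length_append]
      omega
  have htrim : Trimmed ds W' := by
    refine fun l hl => ⟨fun a l' e => ?_, fun a l' e => ?_⟩
    · by_contra ha
      have hch := hW'.chain l hl
      rw [e] at hch
      exact absurd (key l hl [] [a] l' e (by simpa using ha) hch.of_cons) (by simp)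
    · by_contra ha
      have hch := hW'.chain l hl
      rw [e] at hch
      exact absurd (key l hl l' [a] [] (by simp [e]) (by simpa using ha)
        (by simpa using hch.left_of_append)) (by simp)
  refine ⟨W', hW', hc, htrim, ?_⟩
  have hlen : ∀ l ∈ W', l.length ≤ n * l.countP fun e => decide (e ∈ ds) := by
    intro l hl
    refine length_le_mul_countP _ n l (fun x c d y e hcd => ?_)
      fun a l' e => by simpa using (htrim l hl).2 a l' e
    have h1 : ((c ++ [d]).map fun e => e.1.1).Nodup := by
      rw [List.Nodup, List.pairwise_map]
      refine pairwise_of_splits fun x' a y' b z' e' hab => ?_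
      have h2 : ∀ e ∈ a :: y', e ∉ ds := by
        obtain ⟨z₁, z₂, h3⟩ : ∃ z₁ z₂, b :: z' = z₁ ++ [z₂] :=
          ⟨_, _, (List.dropLast_append_getLast (List.cons_ne_nil b z')).symm⟩
        rw [h3, ← List.append_assoc] at e'
        have h4 := (List.append_inj' e' rfl).1
        intro e he
        have h5 : e ∈ c := by rw [h4]; simp only [List.mem_append]; tauto
        simpa using hcd e h5
      have hch := hW'.chain l hl
      rw [e, e'] at hch
      refine absurd (key l hl (x ++ x') (a :: y') (b :: z' ++ y) (by rw [e, e']; simp) h2 ?_)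
        (by simp)
      have hlt := (pairwise_time_lt hch)
      have e₁ : x ++ (x' ++ a :: y' ++ b :: z') ++ y =
          (x ++ x') ++ (a :: (y' ++ (b :: (z' ++ y)))) := by simp
      rw [e₁] at hch hlt
      obtain ⟨h3, h4, h5⟩ := List.isChain_append.1 hch
      rw [← List.cons_append] at h4
      refine List.isChain_append.2 ⟨h3, (List.isChain_append.1 h4).2.1, ?_⟩
      intro p hp q hq
      obtain rfl : b = q := by simpa using hq
      have h6 := link_iff.1 (h5 p hp a (by simp))
      refine link_iff.2 ⟨h6.1.trans hab, h6.2.trans ?_⟩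
      exact (List.pairwise_cons.1 (List.pairwise_append.1 hlt).2.1).1 b (by simp)
    have h2 : (c ++ [d]).map (fun e => e.1.1) ⊆ List.range n := by
      intro w hw
      obtain ⟨f, hf, rfl⟩ := List.mem_map.1 hw
      refine List.mem_range.2 (hn f (hW'.mem f (List.mem_flatten_of_mem hl ?_)))
      rw [e]
      exact List.mem_append_left _ (List.mem_append_right _ hf)
    simpa using (h1.subperm h2).length_le
  have h1 : W'.flatten.length ≤ n * W'.flatten.countP fun e => decide (e ∈ ds) := by
    have : ∀ W'' : List (List (TimeEdge ℕ)), (∀ l ∈ W'', l ∈ W') →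
        W''.flatten.length ≤ n * W''.flatten.countP fun e => decide (e ∈ ds) := by
      intro W'' hs
      induction W'' with
      | nil => simp
      | cons l W'' ih =>
        have h2 := hlen l (hs l (by simp))
        have h3 := ih fun l hl => hs l (List.mem_cons_of_mem _ hl)
        rw [List.flatten_cons, List.length_append, List.countP_append, mul_add]
        omega
    exact this W' fun _ h => h
  refine h1.trans (Nat.mul_le_mul_left n ?_)
  rw [List.countP_eq_length_filter]
  exact ((hW'.nodup.filter _).subperm fun e he =>
    of_decide_eq_true (List.mem_filter.1 he).2).length_le

end Minimal

/-! ### Moving a schedule to few time steps -/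

section Compression

/-- The last time step of a demand that is not later than `t` (`0` if there is none). -/
def lastDemand (ds : List (TimeEdge ℕ)) (t : ℕ) : ℕ :=
  ((ds.map Prod.snd).toFinset.filter (· ≤ t)).sup id

/-- The time step to which `t` is moved: those of the time steps `U` that are not time steps of
demands are moved, in their order, to the steps immediately after the last demand. -/
def compress (ds : List (TimeEdge ℕ)) (U : Finset ℕ) (t : ℕ) : ℕ :=
  lastDemand ds t + (U.filter fun x => lastDemand ds t < x ∧ x ≤ t).card

variable {ds : List (TimeEdge ℕ)} {U : Finset ℕ} {t t' : ℕ}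

theorem lastDemand_le (ds : List (TimeEdge ℕ)) (t : ℕ) : lastDemand ds t ≤ t :=
  Finset.sup_le fun _ hx => (Finset.mem_filter.1 hx).2

theorem le_lastDemand {d : TimeEdge ℕ} (hd : d ∈ ds) (hdt : d.2 ≤ t) : d.2 ≤ lastDemand ds t :=
  Finset.le_sup (f := id) (Finset.mem_filter.2
    ⟨List.mem_toFinset.2 (List.mem_map_of_mem hd), hdt⟩)

theorem exists_lastDemand {d : TimeEdge ℕ} (hd : d ∈ ds) (hdt : d.2 ≤ t) :
    ∃ d' ∈ ds, d'.2 = lastDemand ds t := by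
  have hne : ((ds.map Prod.snd).toFinset.filter (· ≤ t)).Nonempty :=
    ⟨d.2, Finset.mem_filter.2 ⟨List.mem_toFinset.2 (List.mem_map_of_mem hd), hdt⟩⟩
  obtain ⟨x, hx, hx'⟩ := Finset.exists_mem_eq_sup _ hne id
  obtain ⟨d', hd', h⟩ := List.mem_map.1 (List.mem_toFinset.1 (Finset.mem_filter.1 hx).1)
  exact ⟨d', hd', h.trans hx'.symm⟩

theorem compress_le (ds : List (TimeEdge ℕ)) (U : Finset ℕ) (t : ℕ) : compress ds U t ≤ t := by
  have h1 : (U.filter fun x => lastDemand ds t < x ∧ x ≤ t) ⊆ Finset.Ioc (lastDemand ds t) t :=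
    fun x hx => Finset.mem_Ioc.2 (Finset.mem_filter.1 hx).2
  have h2 := Finset.card_le_card h1
  rw [Nat.card_Ioc] at h2
  have := lastDemand_le ds t
  rw [compress]
  omega

theorem compress_demand {d : TimeEdge ℕ} (hd : d ∈ ds) : compress ds U d.2 = d.2 :=
  (compress_le ds U d.2).antisymm ((le_lastDemand hd le_rfl).trans (Nat.le_add_right _ _))

/-- Time steps of `U` keep their order. -/
theorem compress_lt {d : TimeEdge ℕ} (hd : d ∈ ds) (hdt : d.2 ≤ t) (ht' : t' ∈ U) (h : t < t') :
    compress ds U t < compress ds U t' := by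
  obtain ⟨d₁, hd₁, h₁⟩ := exists_lastDemand hd hdt
  obtain ⟨d₂, hd₂, h₂⟩ := exists_lastDemand hd (hdt.trans h.le)
  have hmono : lastDemand ds t ≤ lastDemand ds t' := by
    rw [← h₁]
    exact le_lastDemand hd₁ (h₁ ▸ (lastDemand_le ds t).trans h.le)
  rcases hmono.lt_or_eq with hlt | heq
  · have h3 : t < lastDemand ds t' := by
      by_contra! h4
      have := le_lastDemand hd₂ (h₂.le.trans h4)
      omega
    exact (compress_le ds U t).trans_lt (h3.trans_le (Nat.le_add_right _ _))
  · rw [compress, compress, ← heq]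
    refine Nat.add_lt_add_left (Finset.card_lt_card ?_) _
    refine Finset.ssubset_iff_of_subset (fun x hx => ?_) |>.2 ⟨t', ?_, ?_⟩
    · simp only [Finset.mem_filter] at hx ⊢
      exact ⟨hx.1, hx.2.1, hx.2.2.trans h.le⟩
    · exact Finset.mem_filter.2 ⟨ht', (lastDemand_le ds t).trans_lt h, le_rfl⟩
    · exact fun hx => absurd (Finset.mem_filter.1 hx).2.2 (not_le.2 h)

/-- The time steps that are kept: those at most `B` later than some demand and not later than all of
them. -/
def Kept (ds : List (TimeEdge ℕ)) (B t : ℕ) : Prop :=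
  (∃ d ∈ ds, d.2 ≤ t ∧ t ≤ d.2 + B) ∧ ∃ d ∈ ds, t ≤ d.2

/-- A trimmed schedule with at most `B` time-edges can be moved to the kept time steps. -/
theorem exists_cover_kept {χ : Bounded} {h B : ℕ} {Q : ℕ × ℕ → Prop}
    {W : List (List (TimeEdge ℕ))}
    (hW : IsCover (fun e => Q e.1 ∧ ∃ d ∈ ds, e.2 ≤ d.2) ds W) (ht : Trimmed ds W)
    (hB : W.flatten.length ≤ B) :
    ∃ W', IsCover (fun e => Q e.1 ∧ Kept ds B e.2) ds W' ∧ Trimmed ds W' ∧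
      coverCost χ h W' = coverCost χ h W := by
  set U : Finset ℕ := (W.flatten.map Prod.snd).toFinset with hU
  have hUcard : U.card ≤ B := by
    refine (List.toFinset_card_le _).trans ?_
    rwa [List.length_map]
  let φ : TimeEdge ℕ → TimeEdge ℕ := fun e => (e.1, compress ds U e.2)
  have hφd : ∀ d ∈ ds, φ d = d := fun d hd => Prod.ext rfl (compress_demand hd)
  have hmemU : ∀ e ∈ W.flatten, e.2 ∈ U := fun e he =>
    List.mem_toFinset.2 (List.mem_map_of_mem he)
  -- every walk begins with a demand
  have hdem : ∀ e ∈ W.flatten, ∃ d ∈ ds, d.2 ≤ e.2 := by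
    intro e he
    obtain ⟨l, hl, hel⟩ := List.mem_flatten.1 he
    cases l with
    | nil => simp at hel
    | cons a l =>
      refine ⟨a, (ht _ hl).1 a l rfl, ?_⟩
      rcases List.mem_cons.1 hel with rfl | hel
      · exact le_rfl
      · exact ((List.pairwise_cons.1 (pairwise_time_lt (hW.chain _ hl))).1 e hel).le
  have hlt : ∀ e ∈ W.flatten, ∀ e' ∈ W.flatten, e.2 < e'.2 → (φ e).2 < (φ e').2 := by
    intro e he e' he' hee'
    obtain ⟨d, hd, hde⟩ := hdem e he
    exact compress_lt hd hde (hmemU e' he') hee'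
  have hchain : ∀ l ∈ W, (l.map φ).IsChain fun a b => link a b = true := by
    intro l hl
    rw [List.isChain_map]
    have h1 := hW.chain l hl
    refine List.IsChain.imp_of_mem_imp (fun a b ha hb hab => ?_) h1
    have h2 := link_iff.1 hab
    exact link_iff.2 ⟨h2.1, hlt a (List.mem_flatten_of_mem hl ha) b (List.mem_flatten_of_mem hl hb)
      h2.2⟩
  refine ⟨W.map (List.map φ), ⟨?_, ?_, ?_, ?_⟩, ?_, ?_⟩
  · simpa using hchain
  · rw [← List.map_flatten]
    refine hW.nodup.map_on fun a ha b hb hab => ?_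
    have h1 : a.1 = b.1 := (Prod.mk.inj hab).1
    have h2 : (φ a).2 = (φ b).2 := congrArg Prod.snd hab
    refine Prod.ext h1 ?_
    rcases lt_trichotomy a.2 b.2 with h3 | h3 | h3
    · exact absurd h2 (hlt a ha b hb h3).ne
    · exact h3
    · exact absurd h2 (hlt b hb a ha h3).ne'
  · intro e he
    rw [← List.map_flatten] at he
    obtain ⟨a, ha, rfl⟩ := List.mem_map.1 he
    obtain ⟨h1, d', hd', h2⟩ := hW.mem a ha
    obtain ⟨d, hd, h3⟩ := hdem a ha
    obtain ⟨d₁, hd₁, h₁⟩ := exists_lastDemand hd h3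
    refine ⟨h1, ⟨d₁, hd₁, ?_, ?_⟩, d', hd', (compress_le ds U a.2).trans h2⟩
    · rw [h₁]
      exact Nat.le_add_right _ _
    · rw [h₁]
      exact Nat.add_le_add_left ((Finset.card_filter_le _ _).trans hUcard) _
  · intro d hd
    rw [← List.map_flatten]
    exact List.mem_map.2 ⟨d, hW.covers d hd, hφd d hd⟩
  · intro l₀ hl₀
    obtain ⟨l, hl, rfl⟩ := List.mem_map.1 hl₀
    constructor
    · intro a l' e
      obtain ⟨b, l'', rfl, rfl, rfl⟩ := List.map_eq_cons_iff.1 e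
      have := (ht _ hl).1 b l'' rfl
      rwa [hφd b this]
    · intro a l' e
      obtain ⟨l₁, l₂, rfl, rfl, h2⟩ := List.map_eq_append_iff.1 e
      obtain ⟨b, rfl, rfl⟩ := List.map_eq_singleton_iff.1 h2
      have := (ht _ hl).2 b l₁ rfl
      rwa [hφd b this]
  · rw [coverCost, coverCost, List.map_map]
    refine congrArg List.sum (List.map_congr_left fun l hl => ?_)
    simp only [Function.comp_apply, add_right_inj]
    cases hla : l with
    | nil => rfl
    | cons a l' =>
      subst hla
      cases χ
      · rw [List.map_cons, pathWeight_length, pathWeight_length, List.length_map]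
      · have h1 := pathWeight_lifespan (hW.chain _ hl)
        have h2 := hchain _ hl
        rw [List.map_cons] at h2
        have h3 := pathWeight_lifespan h2
        have ha := (ht _ hl).1 a l' rfl
        have hz := (ht _ hl).2 _ _ (List.dropLast_append_getLast (List.cons_ne_nil a l')).symm
        have h4 : (φ a :: l'.map φ).getLast (List.cons_ne_nil _ _) =
            φ ((a :: l').getLast (List.cons_ne_nil a l')) := by
          rw [← List.getLast_map (f := φ) (by simp)]
          rfl
        rw [h4, hφd _ hz, hφd a ha] at h3
        rw [List.map_cons, hφd a ha]
        omega

end Compression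

/-! ### Sorting -/

/-- The elements of a list of numbers in increasing order, without repetitions. -/
def sortNat (l : List ℕ) : List ℕ :=
  l.foldl (fun s t =>
    (s.filter fun x => decide (x < t)) ++ t :: s.filter fun x => decide (t < x)) []

@[fun_prop]
theorem polyTime_sortNat {γ : Type} [Code γ] {l : γ → List ℕ} (hl : PolyTime l) :
    PolyTime fun x => sortNat (l x) := by
  refine .foldl_of_add (b := fun _ => [])
    (f := fun _ s t => (s.filter fun x => decide (x < t)) ++ t :: s.filter fun x => decide (t < x))
    hl (.const []) (by fun_prop) (S := fun n => n + 2) (by fun_prop)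
    (fun a b h => Nat.add_le_add_right h 2) fun x s t _ => ?_
  have h1 := csize_append (s.filter fun x => decide (x < t)) (t :: s.filter fun x => decide (t < x))
  have h2 : csize (s.filter fun x => decide (x < t)) + csize (s.filter fun x => decide (t < x)) ≤
      csize s + 1 := by
    rw [← csize_filter_add (fun x => decide (x < t)) s]
    refine Nat.add_le_add_left ?_ _
    have h3 : (s.filter fun x => decide (t < x)) =
        (s.filter fun x => !decide (x < t)).filter fun x => decide (t < x) := by
      rw [List.filter_filter]
      refine List.filter_congr fun x _ => ?_
      by_cases h : t < x <;> simp only [h, decide_true, decide_false, Bool.true_and, Bool.false_and]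
      simp [h.le]
    rw [h3]
    exact csize_filter_le _ _
  rw [csize_cons] at h1
  omega

theorem mem_sortNat {l : List ℕ} {t : ℕ} : t ∈ sortNat l ↔ t ∈ l := by
  unfold sortNat
  induction l using List.reverseRecOn with
  | nil => simp
  | append_singleton l a ih =>
    rw [List.foldl_append, List.foldl_cons, List.foldl_nil]
    simp only [List.mem_append, List.mem_filter, List.mem_cons, ih, decide_eq_true_eq,
      List.not_mem_nil, or_false]
    rcases lt_trichotomy t a with h | h | h
    · simp [h, h.ne, h.le]
    · simp [h]
    · simp [h, h.ne', h.le]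

theorem pairwise_sortNat (l : List ℕ) : (sortNat l).Pairwise (· < ·) := by
  unfold sortNat
  induction l using List.reverseRecOn with
  | nil => simp
  | append_singleton l a ih =>
    rw [List.foldl_append, List.foldl_cons, List.foldl_nil]
    refine List.pairwise_append.2 ⟨ih.filter _, List.pairwise_cons.2 ⟨fun x hx => ?_, ih.filter _⟩,
      fun x hx y hy => ?_⟩
    · exact of_decide_eq_true (List.mem_filter.1 hx).2
    · have h1 : x < a := of_decide_eq_true (List.mem_filter.1 hx).2
      rcases List.mem_cons.1 hy with rfl | hy
      · exact h1
      · exact h1.trans (of_decide_eq_true (List.mem_filter.1 hy).2)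

/-! ### The algorithm -/

/-- A list of numbers containing the kept time steps, in increasing order. The range is slightly
longer than necessary: its length is the number of demands times one more than that of vertices. -/
def keptSteps (vs : List ℕ) (ds : List (TimeEdge ℕ)) : List ℕ :=
  sortNat ((ds.flatMap fun d => (List.range (ds ×ˢ (0 :: vs)).length).map fun i => d.2 + i).filter
    fun t => ds.any fun d => decide (t ≤ d.2))

/-- The time-edges with edges in `es` at the kept time steps, in the order of time. -/
def nodes (vs : List ℕ) (es : List (ℕ × ℕ)) (ds : List (TimeEdge ℕ)) : List (TimeEdge ℕ) :=
  (keptSteps vs ds).flatMap fun t => es.map fun e => (e, t)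

/-- A number greater than the cost of the schedule with a walk for every demand. -/
def bigCost (ds : List (TimeEdge ℕ)) (h : ℕ) : ℕ := (ds.map fun _ => h).sum + 1

/-- An optimal successor relation on the nodes, in the order of time. -/
def successors (χ : Bounded) (vs : List ℕ) (es : List (ℕ × ℕ)) (ds : List (TimeEdge ℕ)) (h : ℕ) :
    List (TimeEdge ℕ × TimeEdge ℕ) :=
  (nodes vs es ds).flatMap fun b =>
    (Hungarian.matching (succCost χ ds h (bigCost ds h)) (nodes vs es ds)).filter
      fun p => decide (p.2 = b)

/-- The walks computed for the vertices `vs`, edges `es`, demands `ds` and bound `h`. -/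
def solve (χ : Bounded) (vs : List ℕ) (es : List (ℕ × ℕ)) (ds : List (TimeEdge ℕ)) (h : ℕ) :
    List (List (ℕ × ℕ)) :=
  (assemble χ ds h (successors χ vs es ds h)).map toWalk

section PolyTime

variable {γ : Type} [Code γ] {vs : γ → List ℕ} {es : γ → List (ℕ × ℕ)}
  {ds : γ → List (TimeEdge ℕ)} {h : γ → ℕ}

@[fun_prop]
theorem polyTime_keptSteps (hv : PolyTime vs) (hd : PolyTime ds) :
    PolyTime fun x => keptSteps (vs x) (ds x) := by
  unfold keptSteps
  fun_prop

@[fun_prop]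
theorem polyTime_nodes (hv : PolyTime vs) (he : PolyTime es) (hd : PolyTime ds) :
    PolyTime fun x => nodes (vs x) (es x) (ds x) := by
  unfold nodes
  fun_prop

@[fun_prop]
theorem polyTime_bigCost (hd : PolyTime ds) (hh : PolyTime h) :
    PolyTime fun x => bigCost (ds x) (h x) := by
  unfold bigCost
  fun_prop

@[fun_prop]
theorem polyTime_successors (χ : Bounded) (hv : PolyTime vs) (he : PolyTime es) (hd : PolyTime ds)
    (hh : PolyTime h) : PolyTime fun x => successors χ (vs x) (es x) (ds x) (h x) := by
  have hc : PolyTime fun p : (List (TimeEdge ℕ) × ℕ) × TimeEdge ℕ × TimeEdge ℕ =>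
      succCost χ p.1.1 p.1.2 (bigCost p.1.1 p.1.2) p.2.1 p.2.2 := by fun_prop
  have hm := Hungarian.polyTime_matching
    (c := fun p : List (TimeEdge ℕ) × ℕ => succCost χ p.1 p.2 (bigCost p.1 p.2)) hc
    (g := fun x => (ds x, h x)) (by fun_prop) (polyTime_nodes hv he hd)
  unfold successors
  exact .flatMap (f := fun x b => (Hungarian.matching (succCost χ (ds x) (h x)
    (bigCost (ds x) (h x))) (nodes (vs x) (es x) (ds x))).filter fun p => decide (p.2 = b))
    (polyTime_nodes hv he hd) (.filter
      (f := fun (x : γ × TimeEdge ℕ) (p : TimeEdge ℕ × TimeEdge ℕ) => decide (p.2 = x.2))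
      (hm.comp (g := fun p : γ × TimeEdge ℕ => p.1) (by fun_prop))
      (by fun_prop))

theorem polyTime_solve (χ : Bounded) (hv : PolyTime vs) (he : PolyTime es) (hd : PolyTime ds)
    (hh : PolyTime h) : PolyTime fun x => solve χ (vs x) (es x) (ds x) (h x) := by
  unfold solve
  fun_prop

end PolyTime

section Correct

variable {vs : List ℕ} {es : List (ℕ × ℕ)} {ds : List (TimeEdge ℕ)}

theorem mem_keptSteps {t : ℕ} : t ∈ keptSteps vs ds ↔
    (∃ d ∈ ds, ∃ i < ds.length * (vs.length + 1), t = d.2 + i) ∧ ∃ d ∈ ds, t ≤ d.2 := by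
  simp [keptSteps, mem_sortNat, eq_comm (a := t), List.length_product]

theorem Kept.mem_keptSteps {t : ℕ} (h : Kept ds (vs.length * ds.length) t) :
    t ∈ keptSteps vs ds := by
  obtain ⟨⟨d, hd, h1, h2⟩, h3⟩ := h
  refine TEDSC.mem_keptSteps.2 ⟨⟨d, hd, t - d.2, ?_, by omega⟩, h3⟩
  have := List.length_pos_of_mem hd
  rw [mul_add, mul_comm, mul_one]
  omega

theorem mem_nodes {e : TimeEdge ℕ} : e ∈ nodes vs es ds ↔ e.1 ∈ es ∧ e.2 ∈ keptSteps vs ds := by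
  simp only [nodes, List.mem_flatMap, List.mem_map]
  constructor
  · rintro ⟨t, ht, e, he, rfl⟩
    exact ⟨he, ht⟩
  · rintro ⟨h1, h2⟩
    exact ⟨e.2, h2, e.1, h1, rfl⟩

theorem nodup_nodes (hes : es.Nodup) : (nodes vs es ds).Nodup := by
  have h1 : (keptSteps vs ds).Nodup := (pairwise_sortNat _).imp fun h => h.ne
  refine List.pairwise_flatMap.2 ⟨fun t _ => hes.map fun a b h => (Prod.mk.inj h).1,
    h1.imp fun {s t} hst x hx y hy hxy => ?_⟩
  obtain ⟨e, -, rfl⟩ := List.mem_map.1 hx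
  obtain ⟨e', -, rfl⟩ := List.mem_map.1 hy
  exact hst (Prod.mk.inj hxy).2

theorem sorted_nodes : (nodes vs es ds).Pairwise fun a b => a.2 ≤ b.2 := by
  refine List.pairwise_flatMap.2 ⟨fun t _ => ?_,
    (pairwise_sortNat _).imp fun {s t} hst x hx y hy => ?_⟩
  · rw [List.pairwise_map]
    exact List.pairwise_of_forall fun _ _ => le_rfl
  · obtain ⟨e, -, rfl⟩ := List.mem_map.1 hx
    obtain ⟨e', -, rfl⟩ := List.mem_map.1 hy
    exact hst.le

theorem demand_mem_nodes (hde : ∀ d ∈ ds, d.1 ∈ es) {d : TimeEdge ℕ} (hd : d ∈ ds) :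
    d ∈ nodes vs es ds :=
  mem_nodes.2 ⟨hde d hd, mem_keptSteps.2 ⟨⟨d, hd, 0,
    Nat.mul_pos (List.length_pos_of_mem hd) (Nat.succ_pos _), rfl⟩, d, hd, le_rfl⟩⟩

/-- The computed successor relation is a permutation without forbidden pairs, and its cost is a
lower bound for that of every schedule on the nodes. -/
theorem successors_spec (χ : Bounded) {h : ℕ} (hes : es.Nodup) (hds : ds.Nodup)
    (hde : ∀ d ∈ ds, d.1 ∈ es) :
    IsSucc ds (successors χ vs es ds h) ∧
    (successors χ vs es ds h).map Prod.snd = nodes vs es ds ∧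
    ∀ W, IsCover (· ∈ nodes vs es ds) ds W → Trimmed ds W →
      ((successors χ vs es ds h).map fun p => succCost χ ds h (bigCost ds h) p.1 p.2).sum ≤
        coverCost χ h W := by
  have hn : (nodes vs es ds).Nodup := nodup_nodes hes
  obtain ⟨h1, h2, u, v, huv, ht⟩ :=
    Hungarian.matching_spec (succCost χ ds h (bigCost ds h)) hn
  have hL : successors χ vs es ds h = (nodes vs es ds).flatMap fun b =>
    (Hungarian.matching (succCost χ ds h (bigCost ds h)) (nodes vs es ds)).filter
      fun p => decide (p.2 = b) := rfl
  set L := successors χ vs es ds h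
  set μ := Hungarian.matching (succCost χ ds h (bigCost ds h)) (nodes vs es ds)
  set N := nodes vs es ds
  have hμn : (μ.map Prod.snd).Nodup := h2.nodup_iff.2 hn
  have hsnd : L.map Prod.snd = N := by
    have h3 : ∀ b ∈ N, (μ.filter fun p => decide (p.2 = b)).map Prod.snd = [b] := by
      intro b hb
      have h4 : (μ.filter fun p => decide (p.2 = b)).map Prod.snd =
          (μ.map Prod.snd).filter fun c => decide (c = b) := by
        rw [List.filter_map]
        rfl
      rw [h4, List.filter_eq, List.count_eq_one_of_mem hμn (h2.symm.subset hb)]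
      rfl
    rw [hL, List.map_flatMap, List.flatMap_congr h3]
    simp
  have hLμ : L ~ μ := by
    refine (List.perm_ext_iff_of_nodup ?_ hμn.of_map).2 fun p => ?_
    · exact List.Nodup.of_map Prod.snd (hsnd ▸ hn)
    · rw [hL]
      simp only [List.mem_flatMap, List.mem_filter, decide_eq_true_eq]
      exact ⟨fun ⟨b, _, hp, _⟩ => hp,
        fun hp => ⟨p.2, h2.subset (List.mem_map_of_mem hp), hp, rfl⟩⟩
  have hbound : ∀ W, IsCover (· ∈ N) ds W → Trimmed ds W →
      (L.map fun p => succCost χ ds h (bigCost ds h) p.1 p.2).sum ≤ coverCost χ h W := by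
    intro W hW hWt
    have h3 := sum_le_coverCost hn hW hWt huv
    have h4 : (μ.map fun p => u p.1).sum = (N.map u).sum := by
      rw [← (h1.map u).sum_eq, List.map_map]
      rfl
    have h5 : (μ.map fun p => v p.2).sum = (N.map v).sum := by
      rw [← (h2.map v).sum_eq, List.map_map]
      rfl
    have h6 : (μ.map fun p => u p.1) =
        μ.map fun p => succCost χ ds h (bigCost ds h) p.1 p.2 + v p.2 :=
      List.map_congr_left ht
    rw [h6, List.sum_map_add] at h4
    rw [(hLμ.map _).sum_eq]
    omega
  refine ⟨⟨?_, hsnd ▸ hn, ?_, fun p hp => ?_⟩, hsnd, hbound⟩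
  · rw [hsnd]
    exact (hLμ.map _).trans h1
  · have h3 : N.Pairwise fun a b => a.2 ≤ b.2 := sorted_nodes
    rw [← hsnd, List.pairwise_map] at h3
    exact h3
  · -- a forbidden pair would cost more than the schedule with a walk for every demand
    by_contra! hbad
    obtain ⟨h3, h4, h5⟩ := hbad
    have h6 : succCost χ ds h (bigCost ds h) p.1 p.2 = bigCost ds h := by
      have h7 : (decide (p.1 ∈ ds) && decide (p.2 ∈ ds)) = false := by
        rw [← Bool.decide_and]
        exact decide_eq_false fun h => h4 h.1 h.2
      simp [succCost, h3, h5, h7]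
    have hflat : (ds.map fun d => [d]).flatten = ds := by
      rw [← List.flatMap_def, List.flatMap_singleton']
    have h7 := hbound (ds.map fun d => [d]) ⟨?_, by rwa [hflat],
      fun e he => demand_mem_nodes hde (by rwa [hflat] at he), fun d hd => by rwa [hflat]⟩ ?_
    rotate_left
    · intro l hl
      obtain ⟨d, -, rfl⟩ := List.mem_map.1 hl
      exact .singleton d
    rotate_left
    · have h8 : succCost χ ds h (bigCost ds h) p.1 p.2 ≤
          (L.map fun p => succCost χ ds h (bigCost ds h) p.1 p.2).sum :=
        List.le_sum_of_mem (List.mem_map.2 ⟨p, hp, rfl⟩)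
      have h9 : coverCost χ h (ds.map fun d => [d]) = (ds.map fun _ => h).sum := by
        rw [coverCost, List.map_map]
        rfl
      have h10 : bigCost ds h = (ds.map fun _ => h).sum + 1 := rfl
      omega
    · intro l hl
      obtain ⟨d, hd, rfl⟩ := List.mem_map.1 hl
      refine ⟨fun a l' e => ?_, fun a l' e => ?_⟩
      · obtain ⟨rfl, -⟩ := List.cons.inj e
        exact hd
      · obtain ⟨-, h8⟩ := List.append_inj' (s₁ := []) e rfl
        obtain rfl : d = a := by simpa using h8
        exact hd

/-- The pieces computed, and their number in comparison with an arbitrary schedule. -/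
theorem exists_pieces (χ : Bounded) {h : ℕ} (hes : es.Nodup) (hds : ds.Nodup)
    (hde : ∀ d ∈ ds, d.1 ∈ es) (hpos : ∀ d ∈ ds, 1 ≤ d.2) (hvs : ∀ e ∈ es, e.1 < vs.length) :
    ∃ (L : List (TimeEdge ℕ × TimeEdge ℕ)) (ps : List (List (TimeEdge ℕ × ℕ))),
      solve χ vs es ds h = ps.map toWalk ∧ (∀ q ∈ ps, IsPiece χ h L q) ∧
      (ps.flatten.map Prod.fst).Nodup ∧ (∀ d ∈ ds, d ∈ ps.flatten.map Prod.fst) ∧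
      (∀ e ∈ ps.flatten.map Prod.fst, e.1 ∈ es ∧ 1 ≤ e.2 ∧ ∃ d ∈ ds, e.2 ≤ d.2) ∧
      ∀ W, IsCover (fun e => e.1 ∈ es ∧ ∃ d ∈ ds, e.2 ≤ d.2) ds W →
        h * ps.length ≤ coverCost χ h W := by
  obtain ⟨h1, h2, h3⟩ := successors_spec (vs := vs) (h := h) χ hes hds hde
  have h4 := pieces_assemble (χ := χ) (h := h) (bigCost ds h) h1
  refine ⟨_, _, rfl, h4.piece, h4.nodup, fun d hd => ?_, fun e he => ?_, fun W hW => ?_⟩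
  · have h5 : d ∈ nodes vs es ds := demand_mem_nodes hde hd
    rw [← h2] at h5
    obtain ⟨p, hp, rfl⟩ := List.mem_map.1 h5
    refine (h4.mem _).2 ⟨p, hp, rfl, ?_⟩
    rintro ⟨h6, h7⟩
    exact h7 (h6 ▸ hd)
  · obtain ⟨p, hp, rfl, -⟩ := (h4.mem _).1 he
    have h5 : p.2 ∈ nodes vs es ds := by
      rw [← h2]
      exact List.mem_map_of_mem hp
    obtain ⟨h6, h7⟩ := mem_nodes.1 h5
    obtain ⟨⟨d, hd, i, -, h8⟩, h9⟩ := mem_keptSteps.1 h7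
    have := hpos d hd
    exact ⟨h6, by omega, h9⟩
  · obtain ⟨W', hW', hc, ht, hlen⟩ := exists_short_cover (χ := χ) (h := h) (n := vs.length)
      (fun e he => hvs e.1 he.1) hW
    obtain ⟨W'', hW'', ht'', hc''⟩ :=
      exists_cover_kept (χ := χ) (h := h) (Q := (· ∈ es)) hW' ht hlen
    refine (h4.mul_length_le h1).trans ((h3 W'' ⟨hW''.chain, hW''.nodup, fun e he => ?_,
      hW''.covers⟩ ht'').trans (hc''.le.trans hc))
    obtain ⟨h5, h6⟩ := hW''.mem e he
    exact mem_nodes.2 ⟨h5, h6.mem_keptSteps⟩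

end Correct

/-! ### Instances -/

section Walks

variable {V V' : Type*}

/-- Rename the vertices of a time-edge. -/
def mapEdge (f : V → V') (e : TimeEdge V) : TimeEdge V' := ((f e.1.1, f e.1.2), e.2)

/-- Rename the vertices of a sequence of time-vertices. -/
def mapWalk (f : V → V') (p : List (V × ℕ)) : List (V' × ℕ) := p.map fun a => (f a.1, a.2)

theorem walkEdges_cons_cons (a b : V × ℕ) (p : List (V × ℕ)) :
    walkEdges (a :: b :: p) = ((a.1, b.1), a.2) :: walkEdges (b :: p) := rfl

theorem walkEdges_mapWalk (f : V → V') (p : List (V × ℕ)) :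
    walkEdges (mapWalk f p) = (walkEdges p).map (mapEdge f) := by
  induction p with
  | nil => rfl
  | cons a p ih =>
    cases p with
    | nil => rfl
    | cons b p =>
      rw [walkEdges_cons_cons, List.map_cons, ← ih]
      rfl

theorem cost_mapWalk (χ : Bounded) (f : V → V') (p : List (V × ℕ)) :
    χ.cost (mapWalk f p) = χ.cost p := by
  cases χ
  · simp only [Bounded.cost, walkLength, walkEdges_mapWalk, List.length_map]
  · simp only [Bounded.cost]
    cases p with
    | nil => rfl
    | cons a p =>
      have h1 : a :: p = (a :: p).dropLast ++ [(a :: p).getLast (List.cons_ne_nil a p)] :=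
        (List.dropLast_append_getLast _).symm
      have h2 : mapWalk f (a :: p) = mapWalk f (a :: p).dropLast ++
          [(f ((a :: p).getLast (List.cons_ne_nil a p)).1,
            ((a :: p).getLast (List.cons_ne_nil a p)).2)] := by
        conv_lhs => rw [h1]
        simp [mapWalk]
      rw [walkLifespan_eq _ a _ p _ rfl h1,
        walkLifespan_eq (mapWalk f (a :: p)) (f a.1, a.2) _ (mapWalk f p) _ rfl h2]

theorem isChain_walkEdges {p : List (ℕ × ℕ)} (h : (p.map Prod.snd).IsChain (· < ·)) :
    (walkEdges p).IsChain fun a b => link a b = true := by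
  induction p with
  | nil => exact .nil
  | cons a p ih =>
    cases p with
    | nil => exact .nil
    | cons b p =>
      cases p with
      | nil => exact .singleton _
      | cons c p =>
        have h1 := List.isChain_cons_cons.1 h
        exact .cons_cons (link_iff.2 ⟨rfl, h1.1⟩) (ih h1.2)

theorem getLast_walkEdges_lt {a b : ℕ × ℕ} {p : List (ℕ × ℕ)}
    (h : ((a :: b :: p).map Prod.snd).IsChain (· < ·)) :
    ((walkEdges (a :: b :: p)).getLast (List.cons_ne_nil _ _)).2 <
      ((a :: b :: p).getLast (List.cons_ne_nil _ _)).2 := by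
  induction p generalizing a b with
  | nil => exact (List.isChain_cons_cons.1 h).1
  | cons c p ih => exact ih (List.isChain_cons_cons.1 h).2

theorem pathWeight_walkEdges_lt {χ : Bounded} {h : ℕ} {p : List (ℕ × ℕ)}
    (hp : (p.map Prod.snd).IsChain (· < ·)) (hc : χ.cost p ≤ h) (hh : 1 ≤ h) :
    pathWeight χ (walkEdges p) < h := by
  match p with
  | [] => exact hh
  | [a] => exact hh
  | a :: b :: p =>
    refine lt_of_lt_of_le ?_ hc
    cases χ
    · rw [walkEdges_cons_cons, pathWeight_length]
      simp [Bounded.cost, walkLength, walkEdges_cons_cons]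
    · have h1 := getLast_walkEdges_lt hp
      have h2 := isChain_walkEdges hp
      rw [walkEdges_cons_cons] at h2
      have h3 := pathWeight_lifespan h2
      simp only [walkEdges_cons_cons, Bounded.cost, walkLifespan] at h1 h3 ⊢
      omega

end Walks

theorem mapEdge_val_injective {n : ℕ} : Function.Injective (mapEdge (Fin.val (n := n))) := by
  intro a b hab
  simp only [mapEdge, Prod.mk.injEq, Fin.val_inj] at hab
  exact Prod.ext (Prod.ext hab.1.1 hab.1.2) hab.2

/-- The time-edges of a feasible solution with their ends as numbers. -/
noncomputable def Instance.cover (I : Instance) (S : Finset (List (Fin I.n × ℕ))) :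
    List (List (TimeEdge ℕ)) :=
  S.toList.map fun p => walkEdges (mapWalk Fin.val p)

section Instances

variable {I : Instance} {χ : Bounded} {S : Finset (List (Fin I.n × ℕ))}

theorem isChain_mapWalk {V V' : Type*} {f : V → V'} {T : Set (TimeEdge V)} {p : List (V × ℕ)}
    (h : IsTemporalWalk T p) : ((mapWalk f p).map Prod.snd).IsChain (· < ·) := by
  have : (mapWalk f p).map Prod.snd = p.map Prod.snd := by simp [mapWalk, Function.comp_def]
  rw [this]
  exact h.2.1

theorem Instance.Feasible.isCover (hS : I.Feasible χ S) {es : List (Fin I.n × Fin I.n)}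
    {ds : List (TimeEdge (Fin I.n))} (hes : ∀ e, e ∈ es ↔ I.G.Adj e.1 e.2)
    (hds : ∀ d, d ∈ ds ↔ d ∈ I.D) :
    IsCover (fun e => e.1 ∈ es.map (Prod.map Fin.val Fin.val) ∧
      ∃ d ∈ ds.map (mapEdge Fin.val), e.2 ≤ d.2) (ds.map (mapEdge Fin.val)) (I.cover S) := by
  obtain ⟨⟨hw, hted⟩, hext, -⟩ := hS
  have hmem : ∀ e, e ∈ (I.cover S).flatten ↔
      ∃ p ∈ S, ∃ f ∈ walkEdges p, mapEdge Fin.val f = e := by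
    intro e
    simp only [Instance.cover, List.mem_flatten, List.mem_map, Finset.mem_toList]
    constructor
    · rintro ⟨_, ⟨p, hp, rfl⟩, he⟩
      rw [walkEdges_mapWalk] at he
      exact ⟨p, hp, List.mem_map.1 he⟩
    · rintro ⟨p, hp, he⟩
      exact ⟨_, ⟨p, hp, rfl⟩, by rw [walkEdges_mapWalk]; exact List.mem_map.2 he⟩
  have hchain : ∀ p ∈ S, (walkEdges (mapWalk Fin.val p)).IsChain fun a b => link a b = true :=
    fun p hp => isChain_walkEdges (isChain_mapWalk (hw p hp))
  refine ⟨fun l hl => ?_, ?_, fun e he => ?_, fun d hd => ?_⟩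
  · obtain ⟨p, hp, rfl⟩ := List.mem_map.1 hl
    exact hchain p (Finset.mem_toList.1 hp)
  · refine List.nodup_flatten.2 ⟨fun l hl => ?_, ?_⟩
    · obtain ⟨p, hp, rfl⟩ := List.mem_map.1 hl
      exact (pairwise_time_lt (hchain p (Finset.mem_toList.1 hp))).imp fun h e =>
        h.ne (congrArg Prod.snd e)
    · rw [Instance.cover, List.pairwise_map]
      refine S.nodup_toList.imp_of_mem fun {p q} hp hq hpq => ?_
      have h1 := hted (Finset.mem_toList.1 hp) (Finset.mem_toList.1 hq) hpq
      rw [walkEdges_mapWalk, walkEdges_mapWalk]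
      intro e he he'
      obtain ⟨f, hf, rfl⟩ := List.mem_map.1 he
      obtain ⟨f', hf', h2⟩ := List.mem_map.1 he'
      obtain rfl := mapEdge_val_injective h2
      exact h1 hf hf'
  · obtain ⟨p, hp, f, hf, rfl⟩ := (hmem e).1 he
    obtain ⟨h1, h2, h3⟩ := (hw p hp).2.2 f hf
    refine ⟨List.mem_map.2 ⟨f.1, (hes _).2 h1, rfl⟩, ?_⟩
    have hne : I.D.Nonempty := by
      by_contra hne
      rw [Finset.not_nonempty_iff_eq_empty] at hne
      rw [hne, lifetime, Finset.sup_empty] at h3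
      exact absurd (h2.trans h3) (by simp)
    obtain ⟨d, hd, h4⟩ := Finset.exists_mem_eq_sup I.D hne Prod.snd
    exact ⟨mapEdge Fin.val d, List.mem_map.2 ⟨d, (hds d).2 hd, rfl⟩, h3.trans h4.le⟩
  · obtain ⟨d, hd', rfl⟩ := List.mem_map.1 hd
    obtain ⟨p, hp, h1⟩ := hext d ((hds d).1 hd')
    exact (hmem _).2 ⟨p, hp, d, h1, rfl⟩

theorem Instance.Feasible.coverCost_le (hS : I.Feasible χ S) :
    coverCost χ I.h (I.cover S) ≤ S.card * (2 * I.h - 1) := by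
  have h1 : ∀ x ∈ (I.cover S).map fun l => I.h + pathWeight χ l, x ≤ 2 * I.h - 1 := by
    intro x hx
    obtain ⟨l, hl, rfl⟩ := List.mem_map.1 hx
    obtain ⟨p, hp, rfl⟩ := List.mem_map.1 hl
    have hp' := Finset.mem_toList.1 hp
    have h2 := hS.2.2 p hp'
    rw [← cost_mapWalk χ Fin.val] at h2
    have := pathWeight_walkEdges_lt (isChain_mapWalk (hS.1.1 p hp')) h2 I.h_pos
    omega
  refine (List.sum_le_card_nsmul _ _ h1).trans (le_of_eq ?_)
  simp [Instance.cover]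

theorem exists_mapWalk_eq {n : ℕ} {p : List (ℕ × ℕ)} (h : ∀ a ∈ p, a.1 < n) :
    ∃ p' : List (Fin n × ℕ), mapWalk Fin.val p' = p := by
  induction p with
  | nil => exact ⟨[], rfl⟩
  | cons a p ih =>
    obtain ⟨p', rfl⟩ := ih fun a ha => h a (List.mem_cons_of_mem _ ha)
    exact ⟨(⟨a.1, h a (by simp)⟩, a.2) :: p', rfl⟩

/-- Pieces that consist of edges of the graph, have no time-edge in common and contain all the
demands give a feasible solution. -/
theorem exists_feasible {es : List (Fin I.n × Fin I.n)} {ds : List (TimeEdge (Fin I.n))}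
    (hes : ∀ e, e ∈ es ↔ I.G.Adj e.1 e.2) (hds : ∀ d, d ∈ ds ↔ d ∈ I.D)
    {L : List (TimeEdge ℕ × TimeEdge ℕ)} {ps : List (List (TimeEdge ℕ × ℕ))}
    (hpiece : ∀ q ∈ ps, IsPiece χ I.h L q) (hnd : (ps.flatten.map Prod.fst).Nodup)
    (hcov : ∀ d ∈ ds.map (mapEdge Fin.val), d ∈ ps.flatten.map Prod.fst)
    (hmem : ∀ e ∈ ps.flatten.map Prod.fst, e.1 ∈ es.map (Prod.map Fin.val Fin.val) ∧ 1 ≤ e.2 ∧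
      ∃ d ∈ ds.map (mapEdge Fin.val), e.2 ≤ d.2) :
    ∃ S : Finset (List (Fin I.n × ℕ)), I.Feasible χ S ∧ S.card = ps.length ∧
      IsScheduleCode S (code (ps.map toWalk)) := by
  classical
  have hlt : ∀ q ∈ ps, ∀ x ∈ q, x.1.1.1 < I.n ∧ x.1.1.2 < I.n := by
    intro q hq x hx
    obtain ⟨h1, -⟩ := hmem x.1 (List.mem_map_of_mem (List.mem_flatten_of_mem hq hx))
    obtain ⟨e, -, h2⟩ := List.mem_map.1 h1
    rw [← h2]
    exact ⟨e.1.2, e.2.2⟩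
  have hlift : ∀ q : List (TimeEdge ℕ × ℕ), ∃ p : List (Fin I.n × ℕ),
      q ∈ ps → mapWalk Fin.val p = toWalk q := by
    intro q
    by_cases hq : q ∈ ps
    · have h1 : ∀ a ∈ toWalk q, a.1 < I.n := by
        intro a ha
        cases hqe : q with
        | nil => simp [hqe, toWalk, listElim] at ha
        | cons e q' =>
          rw [hqe] at ha
          rcases List.mem_append.1 ha with ha | ha
          · obtain ⟨x, hx, rfl⟩ := List.mem_map.1 ha
            exact (hlt q hq x (hqe ▸ List.mem_reverse.1 hx)).1
          · rw [List.mem_singleton.1 ha]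
            exact (hlt q hq e (by simp [hqe])).2
      obtain ⟨p, hp⟩ := exists_mapWalk_eq h1
      exact ⟨p, fun _ => hp⟩
    · exact ⟨[], fun h => absurd h hq⟩
  choose g hg using hlift
  have hedges : ∀ q ∈ ps, (walkEdges (g q)).map (mapEdge Fin.val) = (q.map Prod.fst).reverse := by
    intro q hq
    rw [← walkEdges_mapWalk, hg q hq, (hpiece q hq).walkEdges_toWalk]
  have hne : ∀ q ∈ ps, walkEdges (g q) ≠ [] := by
    intro q hq h1
    have h2 := hedges q hq
    obtain ⟨q', b, h3⟩ := (hpiece q hq).last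
    rw [h1, h3] at h2
    simp at h2
  have hted : ps.Pairwise fun q q' => TED (g q) (g q') := by
    rw [List.map_flatten] at hnd
    have h1 := (List.nodup_flatten.1 hnd).2
    rw [List.pairwise_map] at h1
    refine h1.imp_of_mem fun {q q'} hq hq' h2 e he he' => ?_
    have h3 := List.mem_map_of_mem (f := mapEdge Fin.val) he
    have h4 := List.mem_map_of_mem (f := mapEdge Fin.val) he'
    rw [hedges q hq, List.mem_reverse] at h3
    rw [hedges q' hq', List.mem_reverse] at h4
    exact h2 h3 h4
  have hnodup : (ps.map g).Nodup := by
    rw [List.Nodup, List.pairwise_map]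
    refine hted.imp_of_mem fun {q q'} hq hq' h1 h2 => ?_
    rw [← h2] at h1
    obtain ⟨e, he⟩ := List.exists_mem_of_ne_nil _ (hne q hq)
    exact h1 he he
  have hS : ∀ p, p ∈ (ps.map g).toFinset ↔ ∃ q ∈ ps, g q = p := by simp
  refine ⟨(ps.map g).toFinset, ⟨⟨fun p hp => ?_, fun p hp p' hp' hpp' => ?_⟩, fun d hd => ?_,
    fun p hp => ?_⟩, ?_, ps.map g, hnodup, fun p => by simp, ?_⟩
  · obtain ⟨q, hq, rfl⟩ := (hS p).1 hp
    refine ⟨?_, ?_, fun e he => ?_⟩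
    · intro h1
      exact hne q hq (by rw [h1]; rfl)
    · have h1 := (hpiece q hq).isChain_toWalk
      rw [← hg q hq] at h1
      have : (mapWalk Fin.val (g q)).map Prod.snd = (g q).map Prod.snd := by
        simp [mapWalk, Function.comp_def]
      rwa [this] at h1
    · have h1 := List.mem_map_of_mem (f := mapEdge Fin.val) he
      rw [hedges q hq, List.mem_reverse] at h1
      obtain ⟨x, hx, h2⟩ := List.mem_map.1 h1
      obtain ⟨h3, h4, d, hd, h5⟩ := hmem (mapEdge Fin.val e)
        (List.mem_map.2 ⟨x, List.mem_flatten_of_mem hq hx, h2⟩)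
      obtain ⟨e', he', h6⟩ := List.mem_map.1 h3
      obtain ⟨d', hd', rfl⟩ := List.mem_map.1 hd
      have h7 : e' = e.1 := by
        have h8 : mapEdge Fin.val (e', e.2) = mapEdge Fin.val e := Prod.ext h6 rfl
        exact congrArg Prod.fst (mapEdge_val_injective h8)
      refine ⟨(hes _).1 (h7 ▸ he'), h4, h5.trans ?_⟩
      exact Finset.le_sup (f := Prod.snd) ((hds d').1 hd')
  · obtain ⟨q, hq, rfl⟩ := (hS p).1 hp
    obtain ⟨q', hq', rfl⟩ := (hS p').1 hp'
    have : Std.Symm fun q q' => TED (g q) (g q') := ⟨fun _ _ h => List.Disjoint.symm h⟩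
    exact hted.forall hq hq' fun h => hpp' (h ▸ rfl)
  · obtain ⟨x, hx, h1⟩ := List.mem_map.1 (hcov _ (List.mem_map_of_mem ((hds d).2 hd)))
    obtain ⟨q, hq, hxq⟩ := List.mem_flatten.1 hx
    refine ⟨g q, (hS _).2 ⟨q, hq, rfl⟩, ?_⟩
    have h2 : mapEdge Fin.val d ∈ (walkEdges (g q)).map (mapEdge Fin.val) := by
      rw [hedges q hq, List.mem_reverse]
      exact List.mem_map.2 ⟨x, hxq, h1⟩
    exact (List.mem_map_of_injective mapEdge_val_injective).1 h2
  · obtain ⟨q, hq, rfl⟩ := (hS p).1 hp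
    rw [← cost_mapWalk χ Fin.val, hg q hq]
    exact (hpiece q hq).cost_toWalk_le I.h_pos
  · rw [List.toFinset_card_of_nodup hnodup, List.length_map]
  · have h1 : ∀ q ∈ ps, code (toWalk q) = walkCode (g q) := by
      intro q hq
      rw [← hg q hq]
      simp [code, walkCode, mapWalk, vertexCode, Function.comp_def]
    have h2 : code (ps.map toWalk) = .ofList ((ps.map toWalk).map code) := rfl
    rw [h2, List.map_map, List.map_map]
    exact congrArg _ (List.map_congr_left h1)

end Instances

end TEDSC

open TEDSC

theorem mainTheorem12 (χ : TEDSC.Bounded) :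
    ∃ (P : TEDSC.Prog) (T : Polynomial ℕ),
      ∀ (I : TEDSC.Instance) (x : TEDSC.Data), I.IsCode x →
        ∃ (y : TEDSC.Data) (t : ℕ) (S : Finset (List (Fin I.n × ℕ))),
          TEDSC.Runs P x y t ∧ t ≤ T.eval x.size ∧
          TEDSC.IsScheduleCode S y ∧ I.Feasible χ S ∧
          (S.card : ℝ) ≤ (2 - (I.h : ℝ)⁻¹) * (I.opt χ : ℝ) := by
  have hpoly : PolyTime fun x : List ℕ × List (ℕ × ℕ) × List (TimeEdge ℕ) × ℕ =>
      solve χ x.1 x.2.1 x.2.2.1 x.2.2.2 :=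
    polyTime_solve χ (by fun_prop) (by fun_prop) (by fun_prop) (by fun_prop)
  obtain ⟨P, B, ⟨T, hT⟩, -, hrun⟩ := hpoly
  refine ⟨P, T, fun I x hx => ?_⟩
  obtain ⟨es, ds, hesn, hes, hdsn, hds, rfl⟩ := hx
  have hcode : Code.code (List.range I.n, es.map (Prod.map Fin.val Fin.val),
      ds.map (mapEdge Fin.val), I.h) =
      .pair (.ofList ((List.finRange I.n).map vertexCode))
        (.pair (.ofList (es.map edgeCode)) (.pair (.ofList (ds.map demandCode)) (.nat I.h))) := by
    rw [← List.map_coe_finRange_eq_range]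
    simp only [Code.code, List.map_map]
    rfl
  obtain ⟨t, hr, ht⟩ := hrun (List.range I.n, es.map (Prod.map Fin.val Fin.val),
      ds.map (mapEdge Fin.val), I.h)
  rw [csize, hcode] at ht
  rw [hcode] at hr
  obtain ⟨L, ps, hsol, h1, h2, h3, h4, h5⟩ := exists_pieces (vs := List.range I.n) (h := I.h) χ
    (hesn.map (Fin.val_injective.prodMap Fin.val_injective)) (hdsn.map mapEdge_val_injective)
    (fun d hd => by
      obtain ⟨d, hd', rfl⟩ := List.mem_map.1 hd
      exact List.mem_map.2 ⟨d.1, (hes _).2 (I.adj_of_mem d ((hds d).1 hd')), rfl⟩)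
    (fun d hd => by
      obtain ⟨d, hd', rfl⟩ := List.mem_map.1 hd
      exact I.pos_of_mem d ((hds d).1 hd'))
    (fun e he => by
      obtain ⟨e, -, rfl⟩ := List.mem_map.1 he
      simp)
  obtain ⟨S, hS, hcard, hScode⟩ := exists_feasible hes hds h1 h2 h3 h4
  dsimp only at hr
  rw [hsol] at hr
  refine ⟨_, t, S, hr, ht.trans (hT _), hScode, hS, ?_⟩
  obtain ⟨S₀, hS₀, hcard₀⟩ := Nat.sInf_mem (s := {m | ∃ S, I.Feasible χ S ∧ S.card = m})
    ⟨_, S, hS, rfl⟩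
  have h6 := (h5 _ (hS₀.isCover hes hds)).trans hS₀.coverCost_le
  have hopt : S₀.card = I.opt χ := hcard₀
  rw [← hcard, hopt] at h6
  have hh := I.h_pos
  -- from here on, only arithmetic: `h * |S| ≤ OPT * (2 * h - 1)`
  have h7 : I.h * S.card + I.opt χ ≤ 2 * I.h * I.opt χ := by
    have h8 : I.opt χ * (2 * I.h - 1) + I.opt χ = 2 * I.h * I.opt χ := by
      rw [← Nat.mul_succ, show (2 * I.h - 1).succ = 2 * I.h by omega, mul_comm]
    omega
  have h9 : (0 : ℝ) < I.h := by exact_mod_cast hh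
  have h10 : (I.h : ℝ) * S.card + I.opt χ ≤ 2 * I.h * I.opt χ := by exact_mod_cast h7
  rw [← mul_le_mul_iff_right₀ h9]
  have h11 : (I.h : ℝ) * ((2 - (I.h : ℝ)⁻¹) * I.opt χ) = 2 * I.h * I.opt χ - I.opt χ := by
    field_simp
  rw [h11]
  linarith
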